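/- **Setting.** Let $e_3=(0,0,1)^T$, let $\hat a\,y=a\times y$ for $a,y\in\mathbb R^3$, and let $\vee$ be the inverse of the hat map. $\lambda_m,\lambda_M$ denote minimum and maximum eigenvalues, $\|\cdot\|$ the Euclidean norm and the matrix two-norm. Let $m>0$, $g\in\mathbb R$, $J\in\mathbb R^{3\times3}$ symmetric positive definite, and let $\Delta_x,\Delta_R\in\mathbb R^3$ be constant (unknown) disturbances with $\|\Delta_x\|_\infty\le\delta_x$. Let $x_d$ be a smooth position command with $\|-mge_3+m\ddot x_d(t)\|<B_1$ for $t\ge 0$. The quadrotor dynamics, with $R\in\mathrm{SO}(3)$, are $$\dot x=v,\quad m\dot v=mge_3-fRe_3+\Delta_x,\quad \dot R=R\hat\Omega,\quad J\dot\Omega+\Omega\times J\Omega=M+\Delta_R .$$ Let $k_x,k_v,k_i,k_R,k_\Omega,k_I,c_1,c_2,\sigma>0$, and let $\mathrm{sat}_\sigma$ be the saturation to $[-\sigma,\sigma]$, applied coordinatewise. Put $e_x=x-x_d$, $e_v=v-\dot x_d$, $$A=-k_xe_x-k_ve_v-k_i\,\mathrm{sat}_\sigma(e_i)-mge_3+m\ddot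 x_d,\qquad b_{3c}=-A/\|A\|,\qquad R_c=[\,b_{1c};\,b_{3c}\times b_{1c};\,b_{3c}\,],$$ where $b_{1c}$ is any choice of a unit vector orthogonal to $b_{3c}$, $\hat\Omega_c=R_c^T\dot R_c$, and $$\Psi(R,R_c)=\tfrac12\mathrm{tr}(I-R_c^TR),\quad e_R=\tfrac12(R_c^TR-R^TR_c)^\vee,\quad e_\Omega=\Omega-R^TR_c\Omega_c,$$ $$\dot e_i=e_v+c_1e_x,\qquad \dot e_I=e_\Omega+c_2e_R,$$ $$f=-A\cdot Re_3,\qquad M=-k_Re_R-k_\Omega e_\Omega-k_Ie_I+(R^TR_c\Omega_c)^\wedge JR^TR_c\Omega_c+JR^TR_c\dot\Omega_c .$$ The closed-loop motions considered are the classical solutions on a time interval $[t_0,T)$, $t_0\ge 0$ ($T$ arbitrary), along which $A\neq0$, $\Omega_c$ and $\dot\Omega_c$ exist, and $\|2J-\mathrm{tr}(J)I\|\,\|\Omega_c(t)\|\le B_2$. Write $$z=(e_x,e_v,e_R,e_\Omega),\qquad \zeta=\big(e_x,e_v,e_R,e_\Omega,\,e_i-\tfrac{\Delta_x}{k_i},\,e_I-\tfrac{\Delta_R}{k_I}\big).$$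 **Hypotheses.** Let $0<\psi_1<1$, $e_{x_{\max}}>0$, $\alpha=\sqrt{\psi_1(2-\psi_1)}$, and suppose that $$k_i\sigma>\delta_x,\qquad c_1<\min\Big\{\frac{4k_xk_v(1-\alpha)^2}{k_v^2(1+\alpha)^2+4mk_x(1-\alpha)},\ \sqrt{k_x/m}\Big\},\qquad \lambda_m(W_2)>\frac{\|W_{12}\|^2}{4\lambda_m(W_1)},$$ $$c_2<\min\Big\{\frac{\sqrt{k_R\lambda_m(J)}}{\lambda_M(J)},\ \frac{4k_Rk_\Omega}{8k_R\lambda_M(J)+(k_\Omega+B_2)^2}\Big\},$$ where $$W_1=\begin{bmatrix}c_1k_x(1-\alpha)&-\frac{c_1k_v}{2}(1+\alpha)\\-\frac{c_1k_v}{2}(1+\alpha)&k_v(1-\alpha)-mc_1\end{bmatrix},\quad W_{12}=\begin{bmatrix}c_1(\sqrt3k_i\sigma+B_1)&0\\k_i\sigma+B_1+k_xe_{x_{\max}}&0\end{bmatrix},\quad W_2=\begin{bmatrix}c_2k_R&-\frac{c_2}{2}(k_\Omega+B_2)\\-\frac{c_2}{2}(k_\Omega+B_2)&k_\Omega-2c_2\lambda_M(J)\end{bmatrix}.$$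 **Conclusion.** The equilibrium $\zeta=0$ (zero tracking errors) is exponentially stable with respect to $e_x,e_v,e_R,e_\Omega$, and the integral terms are uniformly bounded: 1. There are $\delta,C,\beta>0$ such that every closed-loop motion whose initial conditions satisfy $\Psi(R(t_0),R_c(t_0))<\psi_1$, $\|e_x(t_0)\|<e_{x_{\max}}$ and $\|\zeta(t_0)\|<\delta$ satisfies, for all $t\in[t_0,T)$, $\Psi(R(t),R_c(t))<\psi_1$, $\|e_x(t)\|<e_{x_{\max}}$, $$\|z(t)\|\le C\,\|\zeta(t_0)\|\,e^{-\beta(t-t_0)},\qquad \|e_i(t)\|\le C,\quad \|e_I(t)\|\le C .$$ 2. For every $r>0$ there are $C,\beta>0$ such that the same three bounds hold on $[t_0,T)$ for every closed-loop motion with $\|\zeta(t_0)\|\le r$ that remains in the domain $\{\Psi<\psi_1,\ \|e_x\|<e_{x_{\max}}\}$ on $[t_0,T)$ (in particular when $t_0=0$ and $e_i(0)=e_I(0)=0$). The constants do not depend on the motion, on $t_0$ or on $T$. -/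

import Mathlib

open scoped Matrix ContDiff

namespace Quadrotor

noncomputable section

/-! ### Vectors and matrices -/

/-- Three-dimensional space with the Euclidean norm. -/
abbrev E3 : Type := EuclideanSpace ℝ (Fin 3)

/-- Real three by three matrices. -/
abbrev M3 : Type := Matrix (Fin 3) (Fin 3) ℝ

/-- The third standard basis vector. -/
def e3 : E3 := !₂[0, 0, 1]

/-- The matrix-vector product `A y`. -/
def act (A : M3) (y : E3) : E3 := WithLp.toLp 2 (A *ᵥ y.ofLp)

/-- The cross product `a × b`. -/
def cross (a b : E3) : E3 := WithLp.toLp 2 (crossProduct a.ofLp b.ofLp)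

/-- The hat map: the skew-symmetric matrix with `hat a * y = a × y`. -/
def hat (a : E3) : M3 := !![0, -a 2, a 1; a 2, 0, -a 0; -a 1, a 0, 0]

theorem act_hat (a y : E3) : act (hat a) y = cross a y := by
  ext i
  fin_cases i <;>
    simp [act, hat, cross, crossProduct, dotProduct, Fin.sum_univ_three] <;> ring

/-- The vee map, the inverse of the hat map on skew-symmetric matrices. -/
def vee (S : M3) : E3 := !₂[S 2 1, S 0 2, S 1 0]

theorem vee_hat (a : E3) : vee (hat a) = a := by
  ext i
  fin_cases i <;> simp [vee, hat]

theorem hat_vee (S : M3) (hS : Sᵀ = -S) : hat (vee S) = S := by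
  have h : ∀ i j, S j i = -S i j := fun i j => by
    simpa using congrFun (congrFun hS i) j
  have h0 := h 0 0
  have h1 := h 1 1
  have h2 := h 2 2
  ext i j
  fin_cases i <;> fin_cases j <;> simp [vee, hat] <;>
    linarith [h 0 1, h 0 2, h 1 2, h 1 0, h 2 0, h 2 1]

/-- The two-norm (induced by the Euclidean norm) of a square matrix. -/
def specNorm {n : Type} [Fintype n] [DecidableEq n] (A : Matrix n n ℝ) : ℝ :=
  ‖Matrix.toEuclideanCLM (n := n) (𝕜 := ℝ) A‖

/-- The minimum eigenvalue; it is used for symmetric matrices only. -/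
def minEig {n : Type} [Fintype n] [DecidableEq n] (A : Matrix n n ℝ) : ℝ :=
  sInf (spectrum ℝ A)

/-- The maximum eigenvalue; it is used for symmetric matrices only. -/
def maxEig {n : Type} [Fintype n] [DecidableEq n] (A : Matrix n n ℝ) : ℝ :=
  sSup (spectrum ℝ A)

/-- The scalar saturation function with values in `[-σ, σ]`. -/
def sat (σ y : ℝ) : ℝ := if σ < y then σ else if y < -σ then -σ else y

/-- The saturation function applied to every coordinate of a vector. -/
def satVec (σ : ℝ) (y : E3) : E3 := WithLp.toLp 2 fun i => sat σ (y i)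

/-! ### Attitude errors -/

/-- The attitude error function `Ψ(R, Q) = (1/2) tr(I - Qᵀ R)`. -/
def attitudeFn (R Q : M3) : ℝ := (1 / 2) * (1 - Qᵀ * R).trace

/-- The attitude error vector `(1/2) (Qᵀ R - Rᵀ Q)^∨`. -/
def attitudeErr (R Q : M3) : E3 := (1 / 2 : ℝ) • vee (Qᵀ * R - Rᵀ * Q)

/-! ### The vehicle, the controller and the motion -/

/-- The physical constants of the vehicle and the parameters of the controller. -/
structure Params where
  /-- mass -/
  m : ℝ
  /-- gravitational acceleration -/
  g : ℝ
  /-- inertia matrix -/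
  J : M3
  kx : ℝ
  kv : ℝ
  ki : ℝ
  kR : ℝ
  kΩ : ℝ
  kI : ℝ
  c1 : ℝ
  c2 : ℝ
  /-- saturation level -/
  σ : ℝ

/-- The time histories of position, velocity, attitude, body angular velocity, of the two integral
terms, and of the chosen first axis of the computed attitude. -/
structure Motion where
  x : ℝ → E3
  v : ℝ → E3
  R : ℝ → M3
  Ω : ℝ → E3
  ei : ℝ → E3
  eI : ℝ → E3
  b1c : ℝ → E3

namespace Motion

variable (p : Params) (xd : ℝ → E3) (s : Motion) (I : Set ℝ) (t : ℝ)

/-- Position error `e_x`. -/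
def ex : E3 := s.x t - xd t

/-- Velocity error `e_v`. -/
def ev : E3 := s.v t - deriv xd t

/-- The vector `A = -k_x e_x - k_v e_v - k_i sat_σ(e_i) - m g e_3 + m x_d''`. -/
def forceCmd : E3 :=
  -(p.kx • s.ex xd t) - p.kv • s.ev xd t - p.ki • satVec p.σ (s.ei t) - (p.m * p.g) • e3
    + p.m • deriv (deriv xd) t

/-- The computed thrust direction `b_{3c} = -A / ‖A‖`. -/
def b3c : E3 := -(‖s.forceCmd p xd t‖⁻¹ • s.forceCmd p xd t)

/-- The computed attitude, with columns `b_{1c}`, `b_{3c} × b_{1c}` and `b_{3c}`. -/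
def Rc : M3 :=
  (Matrix.of ![(s.b1c t).ofLp, (cross (s.b3c p xd t) (s.b1c t)).ofLp, (s.b3c p xd t).ofLp])ᵀ

/-- The entrywise time derivative of the computed attitude on the time interval `I`. -/
def dRc : M3 := Matrix.of fun i j => derivWithin (fun τ => s.Rc p xd τ i j) I t

/-- The computed angular velocity `Ω_c`, with `hat Ω_c = R_cᵀ R_c'`. -/
def Ωc : E3 := vee ((s.Rc p xd t)ᵀ * s.dRc p xd I t)

/-- The time derivative of the computed angular velocity on the time interval `I`. -/
def dΩc : E3 := derivWithin (fun τ => s.Ωc p xd I τ) I t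

/-- The attitude error function `Ψ(R, R_c)`. -/
def Ψ : ℝ := attitudeFn (s.R t) (s.Rc p xd t)

/-- The attitude error `e_R`. -/
def eR : E3 := attitudeErr (s.R t) (s.Rc p xd t)

/-- The computed angular velocity in the body frame, `Rᵀ R_c Ω_c`. -/
def bodyΩc : E3 := act ((s.R t)ᵀ * s.Rc p xd t) (s.Ωc p xd I t)

/-- The angular velocity error `e_Ω = Ω - Rᵀ R_c Ω_c`. -/
def eΩ : E3 := s.Ω t - s.bodyΩc p xd I t

/-- The thrust magnitude
`f = (k_x e_x + k_v e_v + k_i sat_σ(e_i) + m g e_3 - m x_d'') · R e_3`. -/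
def thrust : ℝ :=
  inner ℝ (p.kx • s.ex xd t + p.kv • s.ev xd t + p.ki • satVec p.σ (s.ei t) + (p.m * p.g) • e3
    - p.m • deriv (deriv xd) t) (act (s.R t) e3)

/-- The control moment
`M = -k_R e_R - k_Ω e_Ω - k_I e_I + (Rᵀ R_c Ω_c)^ J Rᵀ R_c Ω_c + J Rᵀ R_c Ω_c'`. -/
def moment : E3 :=
  -(p.kR • s.eR p xd t) - p.kΩ • s.eΩ p xd I t - p.kI • s.eI t
    + act (hat (s.bodyΩc p xd I t)) (act p.J (s.bodyΩc p xd I t))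
    + act p.J (act ((s.R t)ᵀ * s.Rc p xd t) (s.dΩc p xd I t))

/-- The size of the tracking errors `(e_x, e_v, e_R, e_Ω)`. -/
def trackErr : ℝ :=
  √(‖s.ex xd t‖ ^ 2 + ‖s.ev xd t‖ ^ 2 + ‖s.eR p xd t‖ ^ 2 + ‖s.eΩ p xd I t‖ ^ 2)

/-- The distance of the full error state `(e_x, e_v, e_R, e_Ω, e_i, e_I)` from the equilibrium
`(0, 0, 0, 0, Δ_x / k_i, Δ_R / k_I)`. -/
def fullErr (Δx ΔR : E3) : ℝ :=
  √(‖s.ex xd t‖ ^ 2 + ‖s.ev xd t‖ ^ 2 + ‖s.eR p xd t‖ ^ 2 + ‖s.eΩ p xd I t‖ ^ 2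
    + ‖s.ei t - p.ki⁻¹ • Δx‖ ^ 2 + ‖s.eI t - p.kI⁻¹ • ΔR‖ ^ 2)

/-- The motion `s` is a (classical) solution of the closed-loop equations on the time interval
`I`, with constant disturbances `Δx` and `ΔR`. -/
structure IsClosedLoop (Δx ΔR : E3) : Prop where
  R_mem : ∀ t ∈ I, s.R t ∈ Matrix.specialOrthogonalGroup (Fin 3) ℝ
  /-- the computed thrust direction is well defined -/
  forceCmd_ne : ∀ t ∈ I, s.forceCmd p xd t ≠ 0
  /-- the first axis is a unit vector orthogonal to the computed thrust direction -/
  b1c_unit : ∀ t ∈ I, ‖s.b1c t‖ = 1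
  b1c_orth : ∀ t ∈ I, inner ℝ (s.b1c t) (s.b3c p xd t) = 0
  /-- `Ω_c` and `Ω_c'`, which enter the control moment, exist -/
  Rc_diff : ∀ i j, DifferentiableOn ℝ (fun τ => s.Rc p xd τ i j) I
  Ωc_diff : DifferentiableOn ℝ (fun τ => s.Ωc p xd I τ) I
  /-- `x' = v` -/
  x_eq : ∀ t ∈ I, HasDerivWithinAt s.x (s.v t) I t
  /-- `m v' = m g e_3 - f R e_3 + Δ_x` -/
  v_eq : ∀ t ∈ I, ∃ a : E3, HasDerivWithinAt s.v a I t ∧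
    p.m • a = (p.m * p.g) • e3 - s.thrust p xd t • act (s.R t) e3 + Δx
  /-- `R' = R hat Ω`, entry by entry -/
  R_eq : ∀ t ∈ I, ∀ i j,
    HasDerivWithinAt (fun τ => s.R τ i j) ((s.R t * hat (s.Ω t)) i j) I t
  /-- `J Ω' + Ω × J Ω = M + Δ_R` -/
  Ω_eq : ∀ t ∈ I, ∃ w : E3, HasDerivWithinAt s.Ω w I t ∧
    act p.J w + cross (s.Ω t) (act p.J (s.Ω t)) = s.moment p xd I t + ΔR
  /-- `e_i' = e_v + c_1 e_x` -/
  ei_eq : ∀ t ∈ I, HasDerivWithinAt s.ei (s.ev xd t + p.c1 • s.ex xd t) I t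
  /-- `e_I' = e_Ω + c_2 e_R` -/
  eI_eq : ∀ t ∈ I, HasDerivWithinAt s.eI (s.eΩ p xd I t + p.c2 • s.eR p xd t) I t

end Motion

/-! ### The gain matrices -/

/-- The matrix `W_1`. -/
def W1 (p : Params) (α : ℝ) : Matrix (Fin 2) (Fin 2) ℝ :=
  !![p.c1 * p.kx * (1 - α), -(p.c1 * p.kv / 2) * (1 + α);
     -(p.c1 * p.kv / 2) * (1 + α), p.kv * (1 - α) - p.m * p.c1]

/-- The matrix `W_{12}`. -/
def W12 (p : Params) (B1 exmax : ℝ) : Matrix (Fin 2) (Fin 2) ℝ :=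
  !![p.c1 * (√3 * p.ki * p.σ + B1), 0;
     p.ki * p.σ + B1 + p.kx * exmax, 0]

/-- The matrix `W_2`. -/
def W2 (p : Params) (B2 : ℝ) : Matrix (Fin 2) (Fin 2) ℝ :=
  !![p.c2 * p.kR, -(p.c2 / 2) * (p.kΩ + B2);
     -(p.c2 / 2) * (p.kΩ + B2), p.kΩ - 2 * p.c2 * maxEig p.J]

end

end Quadrotor

namespace Quadrotor

/-! ### Coordinates -/

/-! The relative attitude Q = R_cᵀR obeys Q' = Q hat(e_Ω), so all attitude facts are facts about a
rotation of angle θ: Ψ = 1 - cos θ, ‖e_R‖ = sin θ, Ψ' = e_R · e_Ω. Tilting the thrust perturbs the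
translational equation by a vector X bounded by (k_x‖e_x‖ + k_v‖e_v‖ + F)‖e_R‖. This reduces the
closed loop to `ErrorDynamics`, where the reference trajectory enters only through bounds.

Write q for the sum of squares of the tracking errors and i for that of the centred integral errors.
The position function `posLyap` contains the primitive of the saturation, which cancels the integral
action in its rate; the attitude function `attLyap` does the same with a quadratic term. Since
`attLyap` dissipates ‖e_R‖² on its own, a sufficiently large multiple L of it pays for the coupling
X, and U = `posLyap` + L `attLyap` satisfies U' ≤ -λ q (`exists_posRate_le`, `exists_attRate_le`).

This rate misses i, so by itself it gives only boundedness. Exponential decay comes from adding a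
small multiple of D = m (e_i - c) · e_v + η · J e_Ω, with c = Δ_x/k_i and η = e_I - Δ_R/k_I:
differentiating D produces a negative multiple of i at the cost of a multiple of q
(`exists_posCross_le`, `exists_attCross_le`, `exp_decay_of_cross_term`). The saturation potential
grows only linearly far away, hence is not globally comparable with ‖e_i - c‖². Monotonicity of U
confines e_i to a box determined by the initial size r, and on this box the comparison holds; this
is why the constants depend on r.

For small initial errors the decay estimate itself yields bounds strictly inside the domain, and a
continuity argument (`lt_of_bootstrap`) makes the domain invariant. -/

theorem inner_coord (x y : E3) : inner ℝ x y = x 0 * y 0 + x 1 * y 1 + x 2 * y 2 := by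
  simp only [PiLp.inner_apply, Fin.sum_univ_three, RCLike.inner_apply, conj_trivial]
  ring

theorem norm_sq_coord (x : E3) : ‖x‖ ^ 2 = x 0 ^ 2 + x 1 ^ 2 + x 2 ^ 2 := by
  rw [EuclideanSpace.real_norm_sq_eq, Fin.sum_univ_three]

theorem act_apply (A : M3) (y : E3) (i : Fin 3) :
    act A y i = A i 0 * y 0 + A i 1 * y 1 + A i 2 * y 2 := by
  simp [act, Matrix.mulVec, dotProduct, Fin.sum_univ_three]

theorem act_eq_clm (A : M3) (y : E3) : act A y = Matrix.toEuclideanCLM (n := Fin 3) (𝕜 := ℝ) A y :=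
  rfl

theorem cross_apply_zero (a b : E3) : cross a b 0 = a 1 * b 2 - a 2 * b 1 := by
  simp [cross, crossProduct]

theorem cross_apply_one (a b : E3) : cross a b 1 = a 2 * b 0 - a 0 * b 2 := by
  simp [cross, crossProduct]

theorem cross_apply_two (a b : E3) : cross a b 2 = a 0 * b 1 - a 1 * b 0 := by
  simp [cross, crossProduct]

theorem ext_coord {x y : E3} (h0 : x 0 = y 0) (h1 : x 1 = y 1) (h2 : x 2 = y 2) : x = y := by
  ext i
  fin_cases i <;> assumption

theorem norm_cross_le (a b : E3) : ‖cross a b‖ ≤ ‖a‖ * ‖b‖ := by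
  refine abs_le_of_sq_le_sq' ?_ (by positivity) |>.2
  rw [mul_pow, norm_sq_coord, norm_sq_coord, norm_sq_coord, cross_apply_zero, cross_apply_one,
    cross_apply_two]
  nlinarith [sq_nonneg (a 0 * b 0 + a 1 * b 1 + a 2 * b 2)]

theorem inner_cross_self (a b : E3) : inner ℝ b (cross a b) = 0 := by
  rw [inner_coord, cross_apply_zero, cross_apply_one, cross_apply_two]
  ring

theorem act_mul (A B : M3) (y : E3) : act (A * B) y = act A (act B y) := by
  simp [act, Matrix.mulVec_mulVec]

theorem norm_act_le (A : M3) (y : E3) : ‖act A y‖ ≤ specNorm A * ‖y‖ :=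
  (Matrix.toEuclideanCLM (n := Fin 3) (𝕜 := ℝ) A).le_opNorm y

theorem inner_act_comm {J : M3} (hJ : Jᵀ = J) (x y : E3) :
    inner ℝ (act J x) y = inner ℝ x (act J y) := by
  have h : ∀ i j, J j i = J i j := fun i j => congrFun (congrFun hJ i) j
  simp only [inner_coord, act_apply]
  rw [h 0 1, h 0 2, h 1 2]
  ring

/-- The gyroscopic terms of the angular velocity error combine into a cross product. -/
theorem gyroscopic_identity {J : M3} (hJ : Jᵀ = J) (e w : E3) :
    act (hat w) (act J w) - cross (e + w) (act J (e + w)) + act J (cross e w)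
      = cross (act J e + act ((2 : ℝ) • J - J.trace • (1 : M3)) w) e := by
  have h : ∀ i j, J j i = J i j := fun i j => congrFun (congrFun hJ i) j
  rw [act_hat]
  apply ext_coord <;>
    simp only [PiLp.add_apply, PiLp.sub_apply, cross_apply_zero, cross_apply_one, cross_apply_two,
      act_apply, Matrix.sub_apply, Matrix.smul_apply, Matrix.trace_fin_three, smul_eq_mul,
      Matrix.one_apply, Fin.isValue] <;>
    simp <;> rw [h 0 1, h 0 2, h 1 2] <;> ring

/-! ### Rotations -/

theorem rot_mul_transpose {Q : M3} (hQ : Q ∈ Matrix.specialOrthogonalGroup (Fin 3) ℝ) :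
    Q * Qᵀ = 1 :=
  (Matrix.mem_orthogonalGroup_iff _ _).1 (Matrix.mem_specialOrthogonalGroup_iff.1 hQ).1

theorem rot_transpose_mul {Q : M3} (hQ : Q ∈ Matrix.specialOrthogonalGroup (Fin 3) ℝ) :
    Qᵀ * Q = 1 :=
  mul_eq_one_comm.1 (rot_mul_transpose hQ)

theorem rot_transpose_mem {Q : M3} (hQ : Q ∈ Matrix.specialOrthogonalGroup (Fin 3) ℝ) :
    Qᵀ ∈ Matrix.specialOrthogonalGroup (Fin 3) ℝ := by
  refine Matrix.mem_specialOrthogonalGroup_iff.2 ⟨(Matrix.mem_orthogonalGroup_iff _ _).2 ?_, ?_⟩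
  · rw [Matrix.transpose_transpose, rot_transpose_mul hQ]
  · rw [Matrix.det_transpose, (Matrix.mem_specialOrthogonalGroup_iff.1 hQ).2]

theorem rot_adjugate {Q : M3} (hQ : Q ∈ Matrix.specialOrthogonalGroup (Fin 3) ℝ) :
    Q.adjugate = Qᵀ := by
  have h := (Matrix.mem_specialOrthogonalGroup_iff.1 hQ).2
  calc Q.adjugate = Q.adjugate * (Q * Qᵀ) := by rw [rot_mul_transpose hQ, mul_one]
    _ = Qᵀ := by rw [← mul_assoc, Matrix.adjugate_mul, h, one_smul, one_mul]

theorem rot_row {Q : M3} (hQ : Q ∈ Matrix.specialOrthogonalGroup (Fin 3) ℝ) (i j : Fin 3) :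
    Q i 0 * Q j 0 + Q i 1 * Q j 1 + Q i 2 * Q j 2 = if i = j then 1 else 0 := by
  have h := congrFun (congrFun (rot_mul_transpose hQ) i) j
  simpa [Matrix.mul_apply, Fin.sum_univ_three, Matrix.one_apply] using h

theorem rot_col {Q : M3} (hQ : Q ∈ Matrix.specialOrthogonalGroup (Fin 3) ℝ) (i j : Fin 3) :
    Q 0 i * Q 0 j + Q 1 i * Q 1 j + Q 2 i * Q 2 j = if i = j then 1 else 0 := by
  have h := congrFun (congrFun (rot_transpose_mul hQ) i) j
  simpa [Matrix.mul_apply, Fin.sum_univ_three, Matrix.one_apply] using h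

/-- Determinant one makes the transpose equal to the adjugate. These quadratic relations are what
the orthogonality relations alone do not give: they exclude reflections. -/
theorem rot_cofactor {Q : M3} (hQ : Q ∈ Matrix.specialOrthogonalGroup (Fin 3) ℝ) :
    (Q 0 0 = Q 1 1 * Q 2 2 - Q 1 2 * Q 2 1 ∧ Q 1 1 = Q 0 0 * Q 2 2 - Q 0 2 * Q 2 0 ∧
      Q 2 2 = Q 0 0 * Q 1 1 - Q 0 1 * Q 1 0) ∧
    (Q 1 0 = -(Q 0 1 * Q 2 2) + Q 0 2 * Q 2 1 ∧ Q 0 1 = -(Q 1 0 * Q 2 2) + Q 1 2 * Q 2 0 ∧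
      Q 2 0 = Q 0 1 * Q 1 2 - Q 0 2 * Q 1 1 ∧ Q 0 2 = Q 1 0 * Q 2 1 - Q 1 1 * Q 2 0 ∧
      Q 2 1 = -(Q 0 0 * Q 1 2) + Q 0 2 * Q 1 0 ∧ Q 1 2 = -(Q 0 0 * Q 2 1) + Q 0 1 * Q 2 0) := by
  have h := rot_adjugate hQ
  rw [Matrix.adjugate_fin_three] at h
  have e : ∀ i j, _ := fun i j => congrFun (congrFun h i) j
  have a00 := e 0 0
  have a01 := e 0 1
  have a02 := e 0 2
  have a10 := e 1 0
  have a11 := e 1 1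
  have a12 := e 1 2
  have a20 := e 2 0
  have a21 := e 2 1
  have a22 := e 2 2
  simp at a00 a01 a02 a10 a11 a12 a20 a21 a22
  exact ⟨⟨a00.symm, a11.symm, a22.symm⟩, a01.symm, a10.symm, a02.symm, a20.symm, a12.symm,
    a21.symm⟩

theorem norm_rot_act {Q : M3} (hQ : Q ∈ Matrix.specialOrthogonalGroup (Fin 3) ℝ) (y : E3) :
    ‖act Q y‖ = ‖y‖ := by
  rw [← sq_eq_sq₀ (norm_nonneg _) (norm_nonneg _), norm_sq_coord, norm_sq_coord]
  simp only [act_apply]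
  have h := rot_col hQ
  have h00 := h 0 0
  have h11 := h 1 1
  have h22 := h 2 2
  have h01 := h 0 1
  have h02 := h 0 2
  have h12 := h 1 2
  simp at h00 h11 h22 h01 h02 h12
  linear_combination y 0 ^ 2 * h00 + y 1 ^ 2 * h11 + y 2 ^ 2 * h22 + 2 * y 0 * y 1 * h01
    + 2 * y 0 * y 2 * h02 + 2 * y 1 * y 2 * h12

/-- The quadratic form of a rotation `Q` is determined by its trace and its axis. -/
theorem rot_quadratic_form {Q : M3} (hQ : Q ∈ Matrix.specialOrthogonalGroup (Fin 3) ℝ) (e : E3) :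
    (1 + Q.trace) * (inner ℝ e (act Q e) - (Q.trace - 1) / 2 * ‖e‖ ^ 2)
      = 1 / 2 * ((Q 2 1 - Q 1 2) * e 0 + (Q 0 2 - Q 2 0) * e 1 + (Q 1 0 - Q 0 1) * e 2) ^ 2 := by
  rw [norm_sq_coord, inner_coord, Matrix.trace_fin_three]
  simp only [act_apply]
  have hc := rot_col hQ
  have hr := rot_row hQ
  have c00 := hc 0 0
  have c11 := hc 1 1
  have c22 := hc 2 2
  have c01 := hc 0 1
  have c02 := hc 0 2
  have c12 := hc 1 2
  have r00 := hr 0 0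
  have r11 := hr 1 1
  have r22 := hr 2 2
  have r01 := hr 0 1
  have r02 := hr 0 2
  have r12 := hr 1 2
  simp at c00 c11 c22 c01 c02 c12 r00 r11 r22 r01 r02 r12
  obtain ⟨⟨q00, q11, q22⟩, q10, q01, q20, q02, q21, q12⟩ := rot_cofactor hQ
  -- With w = vee(Q - Qᵀ), the six identities are the entries of (1 + tr Q)(Q + Qᵀ - (tr Q - 1) I) =
  -- w wᵀ, Rodrigues' formula freed of division.
  have d22 : (1 + Q 2 2) ^ 2 - (Q 0 0 + Q 1 1) ^ 2 = (Q 1 0 - Q 0 1) ^ 2 := by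
    linear_combination 2 * q22 - r00 - r11 + c22
  have d11 : (1 + Q 1 1) ^ 2 - (Q 0 0 + Q 2 2) ^ 2 = (Q 0 2 - Q 2 0) ^ 2 := by
    linear_combination 2 * q11 - r00 - r22 + c11
  have d00 : (1 + Q 0 0) ^ 2 - (Q 1 1 + Q 2 2) ^ 2 = (Q 2 1 - Q 1 2) ^ 2 := by
    linear_combination 2 * q00 - r11 - r22 + c00
  have d01 : (1 + (Q 0 0 + Q 1 1 + Q 2 2)) * (Q 0 1 + Q 1 0)
      = (Q 2 1 - Q 1 2) * (Q 0 2 - Q 2 0) := by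
    linear_combination q01 + q10 + r01 + c01
  have d02 : (1 + (Q 0 0 + Q 1 1 + Q 2 2)) * (Q 0 2 + Q 2 0)
      = (Q 2 1 - Q 1 2) * (Q 1 0 - Q 0 1) := by
    linear_combination q02 + q20 + r02 + c02
  have d12 : (1 + (Q 0 0 + Q 1 1 + Q 2 2)) * (Q 1 2 + Q 2 1)
      = (Q 0 2 - Q 2 0) * (Q 1 0 - Q 0 1) := by
    linear_combination q12 + q21 + r12 + c12
  linear_combination 1 / 2 * e 0 ^ 2 * d00 + 1 / 2 * e 1 ^ 2 * d11 + 1 / 2 * e 2 ^ 2 * d22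
    + e 0 * e 1 * d01 + e 0 * e 2 * d02 + e 1 * e 2 * d12

/-- The square in `rot_quadratic_form` is nonnegative and 1 + tr Q is positive. Geometrically (tr Q
- 1)/2 = cos θ: a rotation by θ turns no vector by more than θ. -/
theorem rot_quadratic_form_ge {Q : M3} (hQ : Q ∈ Matrix.specialOrthogonalGroup (Fin 3) ℝ)
    (ht : 1 < Q.trace) (e : E3) :
    (Q.trace - 1) / 2 * ‖e‖ ^ 2 ≤ inner ℝ e (act Q e) := by
  have h := rot_quadratic_form hQ e
  have h2 : 0 ≤ (1 + Q.trace) * (inner ℝ e (act Q e) - (Q.trace - 1) / 2 * ‖e‖ ^ 2) := by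
    rw [h]; positivity
  have := nonneg_of_mul_nonneg_right h2 (by linarith)
  linarith

/-- This is sin²θ = 1 - cos²θ for the rotation angle θ; applied to R_cᵀR it becomes ‖e_R‖² = Ψ(2 -
Ψ). -/
theorem rot_norm_vee_sq {Q : M3} (hQ : Q ∈ Matrix.specialOrthogonalGroup (Fin 3) ℝ) :
    ‖(1 / 2 : ℝ) • vee (Q - Qᵀ)‖ ^ 2 = 1 - ((Q.trace - 1) / 2) ^ 2 := by
  rw [norm_sq_coord, Matrix.trace_fin_three]
  simp [vee]
  have hr := rot_row hQ
  have r00 := hr 0 0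
  have r11 := hr 1 1
  have r22 := hr 2 2
  simp at r00 r11 r22
  obtain ⟨⟨q00, q11, q22⟩, -⟩ := rot_cofactor hQ
  linear_combination 1 / 4 * (r00 + r11 + r22) - 1 / 2 * (q00 + q11 + q22)

/-- The velocity of the attitude error is at most the angular velocity error. -/
theorem rot_norm_vee_deriv_le {Q : M3} (hQ : Q ∈ Matrix.specialOrthogonalGroup (Fin 3) ℝ)
    (ht : 1 < Q.trace) (e : E3) :
    ‖(1 / 2 : ℝ) • vee (Q * hat e - (Q * hat e)ᵀ)‖ ≤ ‖e‖ := by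
  -- Once the vector is written as (tr Q · e - Qᵀe)/2, expanding its square and using the lower
  -- bound on e · Qᵀe leaves at most (1 + tr Q)/4 · ‖e‖², and tr Q ≤ 3.
  have h1 : (1 / 2 : ℝ) • vee (Q * hat e - (Q * hat e)ᵀ)
      = (1 / 2 : ℝ) • (Q.trace • e - act Qᵀ e) := by
    congr 1
    apply ext_coord <;>
      simp [vee, hat, Matrix.mul_apply, Fin.sum_univ_three, act_apply, Matrix.trace_fin_three] <;>
      ring
  rw [h1, ← abs_of_nonneg (norm_nonneg e), ← abs_of_nonneg (norm_nonneg ((1 / 2 : ℝ) • _)),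
    ← sq_le_sq, norm_smul, mul_pow, norm_sub_sq_real, norm_rot_act (rot_transpose_mem hQ),
    norm_smul, mul_pow, inner_smul_left]
  have h3 := rot_quadratic_form_ge (rot_transpose_mem hQ) (by rwa [Matrix.trace_transpose]) e
  rw [Matrix.trace_transpose] at h3
  have h4 : 0 ≤ ((Q.trace - 1) / 2) ^ 2 ∧ ((Q.trace - 1) / 2) ^ 2 ≤ 1 :=
    ⟨sq_nonneg _, by have := rot_norm_vee_sq hQ; nlinarith [sq_nonneg ‖(1 / 2 : ℝ) • vee (Q - Qᵀ)‖]⟩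
  have h5 : Q.trace ≤ 3 := by nlinarith
  simp only [Real.norm_eq_abs, sq_abs, conj_trivial]
  have h6 : (0 : ℝ) ≤ ‖e‖ ^ 2 := by positivity
  nlinarith [mul_le_mul_of_nonneg_left h3 (by linarith : 0 ≤ Q.trace)]

/-- The trace against a skew matrix sees only the skew part of Q. For Q = R_cᵀR and e = e_Ω this is
the rate of Ψ. -/
theorem rot_trace_mul_hat (Q : M3) (e : E3) :
    -(1 / 2) * (Q * hat e).trace = inner ℝ ((1 / 2 : ℝ) • vee (Q - Qᵀ)) e := by
  rw [inner_coord, Matrix.trace_fin_three]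
  simp [vee, hat, Matrix.mul_apply, Fin.sum_univ_three]
  ring

/-! ### Eigenvalue bounds -/

theorem inner_act_eq_sum {J : M3} (hJ : J.IsHermitian) (x : E3) :
    inner ℝ x (act J x) = ∑ i, hJ.eigenvalues i * inner ℝ (hJ.eigenvectorBasis i) x ^ 2 := by
  have hs : Jᵀ = J := by simpa [Matrix.IsHermitian] using hJ
  rw [← OrthonormalBasis.sum_inner_mul_inner hJ.eigenvectorBasis]
  refine Finset.sum_congr rfl fun i _ => ?_
  rw [← inner_act_comm hs]
  have : act J (hJ.eigenvectorBasis i) = hJ.eigenvalues i • hJ.eigenvectorBasis i := by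
    ext k
    have := congrFun (hJ.mulVec_eigenvectorBasis i) k
    simpa [act] using this
  rw [this, inner_smul_left, real_inner_comm]
  simp only [conj_trivial]
  ring

theorem norm_act_sq_eq_sum {J : M3} (hJ : J.IsHermitian) (x : E3) :
    ‖act J x‖ ^ 2 = ∑ i, hJ.eigenvalues i ^ 2 * inner ℝ (hJ.eigenvectorBasis i) x ^ 2 := by
  have hs : Jᵀ = J := by simpa [Matrix.IsHermitian] using hJ
  rw [← OrthonormalBasis.sum_sq_norm_inner_right hJ.eigenvectorBasis]
  refine Finset.sum_congr rfl fun i _ => ?_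
  rw [← inner_act_comm hs]
  have : act J (hJ.eigenvectorBasis i) = hJ.eigenvalues i • hJ.eigenvectorBasis i := by
    ext k
    have := congrFun (hJ.mulVec_eigenvectorBasis i) k
    simpa [act] using this
  rw [this, inner_smul_left]
  simp only [conj_trivial, Real.norm_eq_abs, sq_abs]
  ring

theorem minEig_le {J : M3} (hJ : J.IsHermitian) (i : Fin 3) : minEig J ≤ hJ.eigenvalues i := by
  rw [minEig, hJ.spectrum_real_eq_range_eigenvalues]
  exact csInf_le (Set.finite_range _).bddBelow ⟨i, rfl⟩

theorem le_maxEig {J : M3} (hJ : J.IsHermitian) (i : Fin 3) : hJ.eigenvalues i ≤ maxEig J := by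
  rw [maxEig, hJ.spectrum_real_eq_range_eigenvalues]
  exact le_csSup (Set.finite_range _).bddAbove ⟨i, rfl⟩

theorem minEig_pos {J : M3} (hJ : J.PosDef) : 0 < minEig J := by
  rw [minEig, hJ.isHermitian.spectrum_real_eq_range_eigenvalues]
  obtain ⟨i, hi⟩ := (Set.range_nonempty hJ.isHermitian.eigenvalues).csInf_mem (Set.finite_range _)
  rw [← hi]
  exact hJ.eigenvalues_pos i

theorem maxEig_pos {J : M3} (hJ : J.PosDef) : 0 < maxEig J :=
  (hJ.eigenvalues_pos 0).trans_le (le_maxEig hJ.isHermitian 0)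

theorem minEig_mul_norm_sq_le {J : M3} (hJ : J.IsHermitian) (x : E3) :
    minEig J * ‖x‖ ^ 2 ≤ inner ℝ x (act J x) := by
  rw [inner_act_eq_sum hJ, ← OrthonormalBasis.sum_sq_norm_inner_right hJ.eigenvectorBasis x,
    Finset.mul_sum]
  refine Finset.sum_le_sum fun i _ => ?_
  rw [Real.norm_eq_abs, sq_abs]
  exact mul_le_mul_of_nonneg_right (minEig_le hJ i) (sq_nonneg _)

theorem norm_act_le_maxEig {J : M3} (hJ : J.PosDef) (x : E3) :
    ‖act J x‖ ≤ maxEig J * ‖x‖ := by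
  have hp := maxEig_pos hJ
  refine abs_le_of_sq_le_sq' ?_ (by positivity) |>.2
  rw [norm_act_sq_eq_sum hJ.isHermitian, mul_pow,
    ← OrthonormalBasis.sum_sq_norm_inner_right hJ.isHermitian.eigenvectorBasis x,
    Finset.mul_sum]
  refine Finset.sum_le_sum fun i _ => ?_
  rw [Real.norm_eq_abs, sq_abs]
  exact mul_le_mul_of_nonneg_right
    (pow_le_pow_left₀ (hJ.eigenvalues_pos i).le (le_maxEig hJ.isHermitian i) 2) (sq_nonneg _)

/-! ### Coordinatewise and entrywise derivatives -/

theorem hasDerivWithinAt_coord {u : ℝ → E3} {u' : E3} {I : Set ℝ} {t : ℝ} :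
    HasDerivWithinAt u u' I t ↔ ∀ i, HasDerivWithinAt (fun τ => u τ i) (u' i) I t := by
  simp only [hasDerivWithinAt_iff_hasFDerivWithinAt, hasFDerivWithinAt_euclidean]
  refine forall_congr' fun i => ?_
  have : (PiLp.proj 2 (fun _ => ℝ) i : E3 →L[ℝ] ℝ) ∘L ContinuousLinearMap.toSpanSingleton ℝ u'
      = ContinuousLinearMap.toSpanSingleton ℝ (u' i) := by
    ext; simp
  rw [this]

/-- The matrix function `F` has entrywise derivative `F'` at `t` within `I`. -/
def HasEntryDeriv (F : ℝ → M3) (F' : M3) (I : Set ℝ) (t : ℝ) : Prop :=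
  ∀ i j, HasDerivWithinAt (fun τ => F τ i j) (F' i j) I t

namespace HasEntryDeriv

variable {F G : ℝ → M3} {F' G' : M3} {I : Set ℝ} {t : ℝ}

theorem mul (hF : HasEntryDeriv F F' I t) (hG : HasEntryDeriv G G' I t) :
    HasEntryDeriv (fun τ => F τ * G τ) (F' * G t + F t * G') I t := by
  intro i j
  have h := HasDerivWithinAt.fun_sum (u := Finset.univ) fun k _ => (hF i k).fun_mul (hG k j)
  simpa only [Matrix.mul_apply, Matrix.add_apply, Finset.sum_add_distrib] using h

theorem transpose (hF : HasEntryDeriv F F' I t) :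
    HasEntryDeriv (fun τ => (F τ)ᵀ) F'ᵀ I t :=
  fun i j => hF j i

theorem sub (hF : HasEntryDeriv F F' I t) (hG : HasEntryDeriv G G' I t) :
    HasEntryDeriv (fun τ => F τ - G τ) (F' - G') I t :=
  fun i j => (hF i j).sub (hG i j)

theorem trace (hF : HasEntryDeriv F F' I t) :
    HasDerivWithinAt (fun τ => (F τ).trace) F'.trace I t := by
  simp only [Matrix.trace_fin_three]
  exact ((hF 0 0).add (hF 1 1)).add (hF 2 2)

theorem vee (hF : HasEntryDeriv F F' I t) :
    HasDerivWithinAt (fun τ => vee (F τ)) (vee F') I t := by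
  rw [hasDerivWithinAt_coord]
  intro i
  fin_cases i
  · simpa [Quadrotor.vee] using hF 2 1
  · simpa [Quadrotor.vee] using hF 0 2
  · simpa [Quadrotor.vee] using hF 1 0

theorem act {u : ℝ → E3} {u' : E3} (hF : HasEntryDeriv F F' I t)
    (hu : HasDerivWithinAt u u' I t) :
    HasDerivWithinAt (fun τ => act (F τ) (u τ)) (act F' (u t) + act (F t) u') I t := by
  rw [hasDerivWithinAt_coord] at hu ⊢
  intro i
  have h := HasDerivWithinAt.fun_sum (u := Finset.univ) fun k _ => (hF i k).fun_mul (hu k)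
  simpa only [Quadrotor.act, Matrix.mulVec, dotProduct, PiLp.add_apply,
    Finset.sum_add_distrib] using h

end HasEntryDeriv

/-! ### Rotated hat matrices, frames, saturation and thrust tilt -/

theorem mul_hat_act_transpose {Q : M3} (hQ : Q ∈ Matrix.specialOrthogonalGroup (Fin 3) ℝ)
    (w : E3) : Q * hat (act Qᵀ w) = hat w * Q := by
  -- A polynomial identity valid for every matrix: conjugating a hat matrix acts on its vector by
  -- the cofactor matrix.
  have h : Q * hat (act Qᵀ w) * Qᵀ = Q.det • hat w := by
    rw [Matrix.det_fin_three]
    ext i j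
    fin_cases i <;> fin_cases j <;>
      simp [hat, Matrix.mul_apply, Fin.sum_univ_three, act_apply] <;> ring
  rw [(Matrix.mem_specialOrthogonalGroup_iff.1 hQ).2, one_smul] at h
  rw [← h, mul_assoc, rot_transpose_mul hQ, mul_one]

theorem rot_mul_mem {P Q : M3} (hP : P ∈ Matrix.specialOrthogonalGroup (Fin 3) ℝ)
    (hQ : Q ∈ Matrix.specialOrthogonalGroup (Fin 3) ℝ) :
    P * Q ∈ Matrix.specialOrthogonalGroup (Fin 3) ℝ :=
  Submonoid.mul_mem _ hP hQ

theorem transpose_hat (a : E3) : (hat a)ᵀ = -hat a := by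
  ext i j
  fin_cases i <;> fin_cases j <;> simp [hat]

theorem hat_sub (a b : E3) : hat (a - b) = hat a - hat b := by
  ext i j
  fin_cases i <;> fin_cases j <;> simp [hat] <;> ring

theorem act_add (A : M3) (x y : E3) : act A (x + y) = act A x + act A y := by
  simp only [act_eq_clm, map_add]

theorem act_sub (A : M3) (x y : E3) : act A (x - y) = act A x - act A y := by
  simp only [act_eq_clm, map_sub]

/-- A matrix with orthonormal, positively oriented columns `b`, `c × b`, `c` is a rotation. -/
theorem frame_mem {b c : E3} (hb : ‖b‖ = 1) (hc : ‖c‖ = 1) (hbc : inner ℝ b c = 0) :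
    (Matrix.of ![b.ofLp, (cross c b).ofLp, c.ofLp])ᵀ
      ∈ Matrix.specialOrthogonalGroup (Fin 3) ℝ := by
  have hb2 := norm_sq_coord b
  have hc2 := norm_sq_coord c
  rw [inner_coord] at hbc
  rw [hb, one_pow] at hb2
  rw [hc, one_pow] at hc2
  have hcb : cross c b 0 ^ 2 + cross c b 1 ^ 2 + cross c b 2 ^ 2 = 1 := by
    rw [cross_apply_zero, cross_apply_one, cross_apply_two]
    -- Lagrange's identity ‖c × b‖² = ‖b‖²‖c‖² - (b · c)².
    linear_combination (-(b 0 * c 0 + b 1 * c 1 + b 2 * c 2)) * hbc - hb2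
      - (b 0 ^ 2 + b 1 ^ 2 + b 2 ^ 2) * hc2
  have hcbb : cross c b 0 * b 0 + cross c b 1 * b 1 + cross c b 2 * b 2 = 0 := by
    rw [cross_apply_zero, cross_apply_one, cross_apply_two]; ring
  have hcbc : cross c b 0 * c 0 + cross c b 1 * c 1 + cross c b 2 * c 2 = 0 := by
    rw [cross_apply_zero, cross_apply_one, cross_apply_two]; ring
  refine Matrix.mem_specialOrthogonalGroup_iff.2 ⟨?_, ?_⟩
  · rw [Matrix.mem_orthogonalGroup_iff, Matrix.transpose_transpose, mul_eq_one_comm]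
    ext i j
    fin_cases i <;> fin_cases j <;>
      simp [Matrix.mul_apply, Fin.sum_univ_three, Matrix.of_apply, Matrix.transpose_apply] <;>
      linarith
  · rw [Matrix.det_transpose, Matrix.det_fin_three]
    simp [Matrix.of_apply]
    rw [cross_apply_zero, cross_apply_one, cross_apply_two] at *
    linear_combination hcb

theorem sat_abs_le {σ : ℝ} (hσ : 0 < σ) (y : ℝ) : |sat σ y| ≤ σ := by
  unfold sat
  split_ifs <;> rw [abs_le] <;> constructor <;> linarith

theorem norm_satVec_le {σ : ℝ} (hσ : 0 < σ) (y : E3) : ‖satVec σ y‖ ≤ √3 * σ := by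
  have h : ∀ i, satVec σ y i ^ 2 ≤ σ ^ 2 := fun i => sq_le_sq' (abs_le.1 (sat_abs_le hσ (y i))).1
    (abs_le.1 (sat_abs_le hσ (y i))).2
  refine abs_le_of_sq_le_sq' ?_ (by positivity) |>.2
  rw [norm_sq_coord, mul_pow, Real.sq_sqrt (by norm_num)]
  linarith [h 0, h 1, h 2]

/-- The error of tilting a force `A` from its direction `-c` to the direction `-b`. -/
theorem norm_tilt_sq {A b c : E3} (hb : ‖b‖ = 1) (hA : A = -(‖A‖ • c)) :
    ‖(inner ℝ A b) • b - A‖ ^ 2 = ‖A‖ ^ 2 * (1 - inner ℝ c b ^ 2) := by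
  have h : inner ℝ A b = -(‖A‖ * inner ℝ c b) := by
    conv_lhs => rw [hA]
    rw [inner_neg_left, inner_smul_left]; simp
  rw [norm_sub_sq_real, norm_smul, hb, inner_smul_left, real_inner_comm A b, h]
  simp only [Real.norm_eq_abs, mul_one, sq_abs, conj_trivial]
  ring

/-! ### The error dynamics -/

/-- The tracking errors `ex`, `ev`, `eR`, `eΩ`, the integral terms `ei`, `eI` and the attitude error
function `Ψ` obey the closed-loop error equations on `I`, the thrust misalignment and the angular
velocity of the reference being known only through bounds. -/
structure ErrorDynamics (p : Params) (F B : ℝ) (Δx ΔR : E3) (I : Set ℝ)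
    (ex ev ei eR eΩ eI : ℝ → E3) (Ψ : ℝ → ℝ) : Prop where
  ex_deriv : ∀ t ∈ I, HasDerivWithinAt ex (ev t) I t
  ev_deriv : ∀ t ∈ I, ∃ a X : E3, HasDerivWithinAt ev a I t ∧
    p.m • a = -(p.kx • ex t) - p.kv • ev t - (p.ki • satVec p.σ (ei t) - Δx) + X ∧
    (Ψ t < 1 → ‖X‖ ≤ (p.kx * ‖ex t‖ + p.kv * ‖ev t‖ + F) * ‖eR t‖)
  ei_deriv : ∀ t ∈ I, HasDerivWithinAt ei (ev t + p.c1 • ex t) I t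
  Ψ_deriv : ∀ t ∈ I, HasDerivWithinAt Ψ (inner ℝ (eR t) (eΩ t)) I t
  eR_deriv : ∀ t ∈ I, ∃ ρ : E3, HasDerivWithinAt eR ρ I t ∧ (Ψ t < 1 → ‖ρ‖ ≤ ‖eΩ t‖)
  eΩ_deriv : ∀ t ∈ I, ∃ w d : E3, HasDerivWithinAt eΩ w I t ∧ ‖d‖ ≤ B ∧
    act p.J w = cross (act p.J (eΩ t) + d) (eΩ t) - p.kR • eR t - p.kΩ • eΩ t
      - (p.kI • eI t - ΔR)
  eI_deriv : ∀ t ∈ I, HasDerivWithinAt eI (eΩ t + p.c2 • eR t) I t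
  eR_sq : ∀ t ∈ I, ‖eR t‖ ^ 2 = Ψ t * (2 - Ψ t)

namespace Motion

variable {p : Params} {xd : ℝ → E3} {s : Motion} {t₀ T t : ℝ} {Δx ΔR : E3}

theorem IsClosedLoop.norm_b3c {I : Set ℝ} (h : s.IsClosedLoop p xd I Δx ΔR) (ht : t ∈ I) :
    ‖s.b3c p xd t‖ = 1 := by
  rw [b3c, norm_neg, norm_smul, norm_inv, norm_norm,
    inv_mul_cancel₀ (norm_ne_zero_iff.2 (h.forceCmd_ne t ht))]

theorem IsClosedLoop.forceCmd_eq {I : Set ℝ} (h : s.IsClosedLoop p xd I Δx ΔR) (ht : t ∈ I) :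
    s.forceCmd p xd t = -(‖s.forceCmd p xd t‖ • s.b3c p xd t) := by
  rw [b3c, smul_neg, neg_neg, smul_smul,
    mul_inv_cancel₀ (norm_ne_zero_iff.2 (h.forceCmd_ne t ht)), one_smul]

theorem IsClosedLoop.Rc_mem {I : Set ℝ} (h : s.IsClosedLoop p xd I Δx ΔR) (ht : t ∈ I) :
    s.Rc p xd t ∈ Matrix.specialOrthogonalGroup (Fin 3) ℝ :=
  frame_mem (h.b1c_unit t ht) (h.norm_b3c ht) (h.b1c_orth t ht)

theorem act_Rc_e3 : act (s.Rc p xd t) e3 = s.b3c p xd t := by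
  apply ext_coord <;> simp [act_apply, Rc, e3]

/-- Differentiating R_cᵀR_c = I shows that R_cᵀR_c' is skew, so the hat map recovers it from Ω_c.
One-sided derivatives at `t₀` are unique because the interval has unique derivatives at each of its
points. -/
theorem IsClosedLoop.Rc_deriv (h : s.IsClosedLoop p xd (Set.Ico t₀ T) Δx ΔR)
    (ht : t ∈ Set.Ico t₀ T) :
    HasEntryDeriv (s.Rc p xd) (s.Rc p xd t * hat (s.Ωc p xd (Set.Ico t₀ T) t))
      (Set.Ico t₀ T) t := by
  have hd : HasEntryDeriv (s.Rc p xd) (s.dRc p xd (Set.Ico t₀ T) t) (Set.Ico t₀ T) t :=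
    fun i j => (h.Rc_diff i j t ht).hasDerivWithinAt
  have hu : UniqueDiffWithinAt ℝ (Set.Ico t₀ T) t := uniqueDiffOn_Ico t₀ T t ht
  have hskew : ((s.Rc p xd t)ᵀ * s.dRc p xd (Set.Ico t₀ T) t)ᵀ
      = -((s.Rc p xd t)ᵀ * s.dRc p xd (Set.Ico t₀ T) t) := by
    have h1 := hd.transpose.mul hd
    have h2 : (s.dRc p xd (Set.Ico t₀ T) t)ᵀ * s.Rc p xd t
        + (s.Rc p xd t)ᵀ * s.dRc p xd (Set.Ico t₀ T) t = 0 := by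
      ext i j
      refine hu.eq_deriv _ (h1 i j) ?_
      refine (hasDerivWithinAt_const t (Set.Ico t₀ T) ((1 : M3) i j)).congr (fun τ hτ => ?_) ?_
      · simp only [rot_transpose_mul (h.Rc_mem hτ)]
      · simp only [rot_transpose_mul (h.Rc_mem ht)]
    rw [Matrix.transpose_mul, Matrix.transpose_transpose]
    exact eq_neg_of_add_eq_zero_left h2
  rw [Ωc, hat_vee _ hskew, ← mul_assoc, rot_mul_transpose (h.Rc_mem ht), one_mul]
  exact hd

theorem bodyΩc_eq {I : Set ℝ} :
    s.bodyΩc p xd I t = act ((s.Rc p xd t)ᵀ * s.R t)ᵀ (s.Ωc p xd I t) := by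
  rw [bodyΩc, Matrix.transpose_mul, Matrix.transpose_transpose]

/-- The product rule gives Q hat(Ω) - hat(Ω_c) Q for Q = R_cᵀR, and hat(Ω_c) Q = Q hat(QᵀΩ_c) merges
both terms into the body-frame error. -/
theorem IsClosedLoop.relative_deriv (h : s.IsClosedLoop p xd (Set.Ico t₀ T) Δx ΔR)
    (ht : t ∈ Set.Ico t₀ T) :
    HasEntryDeriv (fun τ => (s.Rc p xd τ)ᵀ * s.R τ)
      ((s.Rc p xd t)ᵀ * s.R t * hat (s.eΩ p xd (Set.Ico t₀ T) t)) (Set.Ico t₀ T) t := by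
  have hR : HasEntryDeriv s.R (s.R t * hat (s.Ω t)) (Set.Ico t₀ T) t := h.R_eq t ht
  have hQ := rot_mul_mem (rot_transpose_mem (h.Rc_mem ht)) (h.R_mem t ht)
  convert (h.Rc_deriv ht).transpose.mul hR using 1
  rw [eΩ, hat_sub, bodyΩc_eq, mul_sub, mul_hat_act_transpose hQ, Matrix.transpose_mul,
    transpose_hat]
  noncomm_ring

theorem norm_forceCmd_le (hkx : 0 ≤ p.kx) (hkv : 0 ≤ p.kv) (hki : 0 ≤ p.ki) (hσ : 0 < p.σ)
    {B₁ : ℝ} (hB : ‖-((p.m * p.g) • e3) + p.m • deriv (deriv xd) t‖ < B₁) :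
    ‖s.forceCmd p xd t‖
      ≤ p.kx * ‖s.ex xd t‖ + p.kv * ‖s.ev xd t‖ + (√3 * p.ki * p.σ + B₁) := by
  have e : s.forceCmd p xd t = -(p.kx • s.ex xd t) + -(p.kv • s.ev xd t)
      + -(p.ki • satVec p.σ (s.ei t)) + (-((p.m * p.g) • e3) + p.m • deriv (deriv xd) t) := by
    rw [forceCmd]; abel
  rw [e]
  refine (norm_add_le _ _).trans ?_
  have h3 := norm_add₃_le (a := -(p.kx • s.ex xd t)) (b := -(p.kv • s.ev xd t))
    (c := -(p.ki • satVec p.σ (s.ei t)))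
  simp only [norm_neg, norm_smul, Real.norm_eq_abs, abs_of_nonneg hkx, abs_of_nonneg hkv,
    abs_of_nonneg hki] at h3
  have := mul_le_mul_of_nonneg_left (norm_satVec_le hσ (s.ei t)) hki
  linarith

/-- The closed-loop equations imply the error dynamics. -/
theorem IsClosedLoop.errorDynamics (h : s.IsClosedLoop p xd (Set.Ico t₀ T) Δx ΔR) (ht₀ : 0 ≤ t₀)
    (hxd : ContDiff ℝ ∞ xd) (hJ : p.Jᵀ = p.J) {B₁ B₂ : ℝ}
    (hB₁ : ∀ t : ℝ, 0 ≤ t → ‖-((p.m * p.g) • e3) + p.m • deriv (deriv xd) t‖ < B₁)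
    (hB₂ : ∀ t ∈ Set.Ico t₀ T, specNorm ((2 : ℝ) • p.J - p.J.trace • (1 : M3))
      * ‖s.Ωc p xd (Set.Ico t₀ T) t‖ ≤ B₂)
    (hkx : 0 ≤ p.kx) (hkv : 0 ≤ p.kv) (hki : 0 ≤ p.ki) (hσ : 0 < p.σ) :
    ErrorDynamics p (√3 * p.ki * p.σ + B₁) B₂ Δx ΔR (Set.Ico t₀ T) (s.ex xd) (s.ev xd) s.ei
      (s.eR p xd) (s.eΩ p xd (Set.Ico t₀ T)) s.eI (s.Ψ p xd) := by
  have hQ : ∀ t ∈ Set.Ico t₀ T, (s.Rc p xd t)ᵀ * s.R t ∈ Matrix.specialOrthogonalGroup (Fin 3) ℝ :=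
    fun t ht => rot_mul_mem (rot_transpose_mem (h.Rc_mem ht)) (h.R_mem t ht)
  have hΨ : ∀ t, s.Ψ p xd t = 1 - (((s.Rc p xd t)ᵀ * s.R t).trace - 1) / 2 := by
    intro t
    rw [Ψ, attitudeFn, Matrix.trace_sub, Matrix.trace_one, Fintype.card_fin]
    push_cast
    ring
  have heR : ∀ t, s.eR p xd t
      = (1 / 2 : ℝ) • vee ((s.Rc p xd t)ᵀ * s.R t - ((s.Rc p xd t)ᵀ * s.R t)ᵀ) := by
    intro t
    rw [eR, attitudeErr, Matrix.transpose_mul, Matrix.transpose_transpose]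
  have hsq : ∀ t ∈ Set.Ico t₀ T, ‖s.eR p xd t‖ ^ 2 = s.Ψ p xd t * (2 - s.Ψ p xd t) := by
    intro t ht
    rw [heR, hΨ, rot_norm_vee_sq (hQ t ht)]
    ring
  have hd0 : Differentiable ℝ xd := hxd.differentiable (by simp)
  have hd1 : Differentiable ℝ (deriv xd) := by
    have : ContDiff ℝ ∞ (deriv xd) := (contDiff_infty_iff_deriv.1 hxd).2
    exact this.differentiable (by simp)
  refine ⟨fun t ht => ?_, fun t ht => ?_, h.ei_eq, fun t ht => ?_, fun t ht => ?_,
    fun t ht => ?_, h.eI_eq, hsq⟩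
  · exact (h.x_eq t ht).sub (hd0 t).hasDerivAt.hasDerivWithinAt
  · obtain ⟨a, ha, hma⟩ := h.v_eq t ht
    set A := s.forceCmd p xd t with hA
    set b := act (s.R t) e3 with hb
    refine ⟨a - deriv (deriv xd) t, (inner ℝ A b) • b - A,
      ha.sub (hd1 t).hasDerivAt.hasDerivWithinAt, ?_, fun hlt => ?_⟩
    · have hth : s.thrust p xd t = -inner ℝ A b := by
        rw [thrust, ← inner_neg_left, hA, forceCmd]
        congr 1
        abel
      rw [smul_sub, hma, hth, hA, forceCmd, neg_smul]
      abel
    · have he3 : ‖e3‖ = 1 := by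
        rw [← sq_eq_sq₀ (norm_nonneg _) zero_le_one, norm_sq_coord]
        simp [e3]
      have hb1 : ‖b‖ = 1 := by rw [hb, norm_rot_act (h.R_mem t ht), he3]
      have h1 := norm_tilt_sq hb1 (h.forceCmd_eq ht)
      have hin : inner ℝ (s.b3c p xd t) b = inner ℝ e3 (act ((s.Rc p xd t)ᵀ * s.R t) e3) := by
        rw [act_mul, ← act_Rc_e3, inner_coord, inner_coord]
        simp only [act_apply, Matrix.transpose_apply, ← hb]
        ring
      have htr : 1 < ((s.Rc p xd t)ᵀ * s.R t).trace := by have := hΨ t; linarith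
      -- The cosine of the angle between actual and commanded thrust axes is e_3 · Q e_3 ≥ cos θ = 1
      -- - Ψ > 0. Squaring therefore bounds the squared sine of the tilt by sin²θ = ‖e_R‖².
      have h2 := rot_quadratic_form_ge (hQ t ht) htr e3
      rw [he3, ← hin] at h2
      have h3 := norm_forceCmd_le (s := s) hkx hkv hki hσ (hB₁ t (ht₀.trans ht.1))
      refine le_trans ?_ (mul_le_mul_of_nonneg_right h3 (norm_nonneg _))
      refine abs_le_of_sq_le_sq' ?_ (by positivity) |>.2
      rw [h1, mul_pow]
      refine mul_le_mul_of_nonneg_left ?_ (sq_nonneg _)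
      rw [heR, rot_norm_vee_sq (hQ t ht)]
      nlinarith
  · have h1 := ((h.relative_deriv ht).trace.sub_const 1).div_const 2
    have h2 := (hasDerivWithinAt_const t (Set.Ico t₀ T) (1 : ℝ)).sub h1
    rw [heR, ← rot_trace_mul_hat]
    refine (h2.congr (fun τ _ => by simp [hΨ τ]) (by simp [hΨ t])).congr_deriv ?_
    ring
  · have h1 := (h.relative_deriv ht)
    have h2 := (h1.sub h1.transpose).vee.const_smul (1 / 2 : ℝ)
    refine ⟨_, h2.congr (fun τ _ => heR τ) (heR t), fun hlt => ?_⟩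
    exact rot_norm_vee_deriv_le (hQ t ht) (by have := hΨ t; linarith) _
  · obtain ⟨w, hw, hJw⟩ := h.Ω_eq t ht
    have hΩc : HasDerivWithinAt (s.Ωc p xd (Set.Ico t₀ T)) (s.dΩc p xd (Set.Ico t₀ T) t)
        (Set.Ico t₀ T) t := (h.Ωc_diff t ht).hasDerivWithinAt
    have hbd := (h.relative_deriv ht).transpose.act hΩc
    set e := s.eΩ p xd (Set.Ico t₀ T) t with he
    set u := s.bodyΩc p xd (Set.Ico t₀ T) t with hu
    have h1 : HasDerivWithinAt (s.eΩ p xd (Set.Ico t₀ T)) _ (Set.Ico t₀ T) t :=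
      hw.sub (hbd.congr (fun τ _ => bodyΩc_eq) bodyΩc_eq)
    refine ⟨_, act ((2 : ℝ) • p.J - p.J.trace • (1 : M3)) u, h1, ?_, ?_⟩
    · refine (norm_act_le _ _).trans ?_
      rw [hu, bodyΩc_eq, norm_rot_act (rot_transpose_mem (hQ t ht))]
      exact hB₂ t ht
    · have hcr : act ((s.Rc p xd t)ᵀ * s.R t * hat e)ᵀ (s.Ωc p xd (Set.Ico t₀ T) t)
          = -cross e u := by
        rw [Matrix.transpose_mul, transpose_hat, act_mul, ← bodyΩc_eq, ← hu, ← act_hat]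
        ext i
        simp [act, Matrix.neg_mulVec]
      have hΩ : s.Ω t = e + u := by rw [he, hu, eΩ]; abel
      have hg := gyroscopic_identity hJ e u
      rw [hΩ, moment, ← he, ← hu] at hJw
      rw [hcr, act_sub, act_add, show act p.J (-cross e u) = -act p.J (cross e u) by
        simp only [act_eq_clm, map_neg], ← hg, eq_sub_of_add_eq hJw, Matrix.transpose_mul,
        Matrix.transpose_transpose]
      abel

end Motion

/-! ### The potential of the saturated integral action -/

/-- The primitive of `y ↦ sat σ y - c` that vanishes at `c`, for `|c| ≤ σ`. -/
noncomputable def satPot (σ c y : ℝ) : ℝ := 1 / 2 * (y - c) ^ 2 - 1 / 2 * (y - sat σ y) ^ 2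

/-- The saturation is 1-Lipschitz, so its primitive has a quadratic first-order remainder. This
gives differentiability uniformly, corners included. -/
theorem satPot_sub_le {σ : ℝ} (hσ : 0 < σ) (c y y' : ℝ) :
    |satPot σ c y' - satPot σ c y - (sat σ y - c) * (y' - y)| ≤ (y' - y) ^ 2 := by
  unfold satPot sat
  rw [abs_le]
  split_ifs <;> constructor <;> nlinarith [sq_nonneg (y' - y)]

theorem hasDerivAt_satPot {σ : ℝ} (hσ : 0 < σ) (c y : ℝ) :
    HasDerivAt (satPot σ c) (sat σ y - c) y := by
  rw [hasDerivAt_iff_isLittleO]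
  have h1 : (fun y' => satPot σ c y' - satPot σ c y - (y' - y) • (sat σ y - c))
      =O[nhds y] fun y' => (y' - y) ^ 2 := by
    refine Asymptotics.IsBigO.of_bound 1 (Filter.Eventually.of_forall fun y' => ?_)
    rw [one_mul, Real.norm_eq_abs, Real.norm_eq_abs, abs_of_nonneg (sq_nonneg (y' - y)),
      smul_eq_mul, mul_comm]
    exact satPot_sub_le hσ c y y'
  refine h1.trans_isLittleO ?_
  have := Asymptotics.isLittleO_pow_sub_sub y (m := 2) (by norm_num)
  simpa using this

theorem satPot_le (σ c y : ℝ) : satPot σ c y ≤ 1 / 2 * (y - c) ^ 2 := by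
  unfold satPot
  nlinarith [sq_nonneg (y - sat σ y)]

/-- In the unsaturated range the potential is exactly quadratic; beyond it the slope has size at
least the margin `d` by which the equilibrium stays below saturation, so growth is at least linear.
-/
theorem min_le_satPot {σ c d : ℝ} (hd : d ≤ σ - |c|) (hd0 : 0 < d) (y : ℝ) :
    min ((y - c) ^ 2) (d * |y - c|) ≤ 2 * satPot σ c y := by
  have hc := neg_abs_le c
  have hc' := le_abs_self c
  unfold satPot sat
  split_ifs with h1 h2
  · refine (min_le_right _ _).trans ?_
    rw [abs_of_pos (by linarith)]
    nlinarith [mul_nonneg (by linarith : 0 ≤ σ - c - d) (by linarith : 0 ≤ y - c),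
      mul_nonneg (by linarith : 0 ≤ σ - c) (by linarith : 0 ≤ y - σ)]
  · refine (min_le_right _ _).trans ?_
    rw [abs_of_neg (by linarith)]
    nlinarith [mul_nonneg (by linarith : 0 ≤ σ + c - d) (by linarith : 0 ≤ c - y),
      mul_nonneg (by linarith : 0 ≤ σ + c) (by linarith : 0 ≤ -y - σ)]
  · refine (min_le_left _ _).trans ?_
    linarith

theorem min_le_sat_mul {σ c d : ℝ} (hd : d ≤ σ - |c|) (hd0 : 0 < d) (y : ℝ) :
    min ((y - c) ^ 2) (d * |y - c|) ≤ (sat σ y - c) * (y - c) := by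
  have hc := neg_abs_le c
  have hc' := le_abs_self c
  unfold sat
  split_ifs with h1 h2
  · refine (min_le_right _ _).trans ?_
    rw [abs_of_pos (by linarith)]
    nlinarith [mul_nonneg (by linarith : 0 ≤ σ - c - d) (by linarith : 0 ≤ y - c)]
  · refine (min_le_right _ _).trans ?_
    rw [abs_of_neg (by linarith)]
    nlinarith [mul_nonneg (by linarith : 0 ≤ σ + c - d) (by linarith : 0 ≤ c - y)]
  · refine (min_le_left _ _).trans ?_
    nlinarith

/-- On a bounded range linear growth dominates a multiple of the square. This turns the a priori box
for the integral term into quadratic bounds. -/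
theorem div_mul_sq_le_min {d ρ h : ℝ} (hd : 0 < d) (hdρ : d ≤ ρ) (hh : |h| ≤ ρ) :
    d / ρ * h ^ 2 ≤ min (h ^ 2) (d * |h|) := by
  have hρ : 0 < ρ := hd.trans_le hdρ
  refine le_min ?_ ?_
  · exact mul_le_of_le_one_left (sq_nonneg h) ((div_le_one hρ).2 hdρ)
  · rw [div_mul_eq_mul_div, div_le_iff₀ hρ, ← sq_abs]
    nlinarith [mul_le_mul_of_nonneg_left hh (mul_nonneg hd.le (abs_nonneg h))]

/-- The sum over the coordinates of the saturation potentials. -/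
noncomputable def satPotVec (σ : ℝ) (c y : E3) : ℝ := ∑ i, satPot σ (c i) (y i)

variable {σ d : ℝ} {c : E3}

theorem hasDerivWithinAt_satPotVec (hσ : 0 < σ) (c : E3) {u : ℝ → E3} {u' : E3} {I : Set ℝ}
    {t : ℝ} (hu : HasDerivWithinAt u u' I t) :
    HasDerivWithinAt (fun τ => satPotVec σ c (u τ)) (inner ℝ (satVec σ (u t) - c) u') I t := by
  rw [hasDerivWithinAt_coord] at hu
  have h := HasDerivWithinAt.fun_sum (u := Finset.univ) fun i _ =>
    (hasDerivAt_satPot hσ (c i) (u t i)).comp_hasDerivWithinAt t (hu i)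
  refine h.congr_deriv ?_
  rw [inner_coord, Fin.sum_univ_three]
  simp [satVec]

theorem satPotVec_le (σ : ℝ) (c y : E3) : satPotVec σ c y ≤ 1 / 2 * ‖y - c‖ ^ 2 := by
  rw [EuclideanSpace.real_norm_sq_eq, Finset.mul_sum]
  exact Finset.sum_le_sum fun i _ => satPot_le _ _ _

theorem satPot_nonneg (hd : d ≤ σ - |c i|) (hd0 : 0 < d) (y : ℝ) : 0 ≤ satPot σ (c i) y := by
  have := min_le_satPot hd hd0 y
  have : 0 ≤ min ((y - c i) ^ 2) (d * |y - c i|) := le_min (sq_nonneg _) (by positivity)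
  linarith

theorem satPotVec_nonneg (hd : ∀ i, d ≤ σ - |c i|) (hd0 : 0 < d) (y : E3) :
    0 ≤ satPotVec σ c y :=
  Finset.sum_nonneg fun i _ => satPot_nonneg (hd i) hd0 _

/-- Farther than `d` from the equilibrium the linear branch of `min_le_satPot` is the active one, so
bounded potential bounds each coordinate. -/
theorem abs_sub_le_of_satPotVec_le (hd : ∀ i, d ≤ σ - |c i|) (hd0 : 0 < d) {y : E3} {E : ℝ}
    (hE : satPotVec σ c y ≤ E) (i : Fin 3) : |y i - c i| ≤ d + 2 * E / d := by
  have hE0 : 0 ≤ E := (satPotVec_nonneg hd hd0 y).trans hE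
  have h1 : satPot σ (c i) (y i) ≤ E := (Finset.single_le_sum
    (f := fun i => satPot σ (c i) (y i)) (fun j _ => satPot_nonneg (hd j) hd0 _)
    (Finset.mem_univ i)).trans hE
  have h2 := min_le_satPot (hd i) hd0 (y i)
  have h3 : 0 ≤ 2 * E / d := by positivity
  by_contra! hlt
  have h4 : min ((y i - c i) ^ 2) (d * |y i - c i|) = d * |y i - c i| := by
    refine min_eq_right ?_
    rw [← sq_abs]
    nlinarith [abs_nonneg (y i - c i)]
  rw [h4] at h2
  have h5 := mul_lt_mul_of_pos_left hlt hd0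
  rw [mul_add, mul_div_cancel₀ _ hd0.ne'] at h5
  nlinarith

theorem satPotVec_ge (hd : ∀ i, d ≤ σ - |c i|) (hd0 : 0 < d) {ρ : ℝ} (hρ : d ≤ ρ) {y : E3}
    (hy : ∀ i, |y i - c i| ≤ ρ) : d / ρ / 2 * ‖y - c‖ ^ 2 ≤ satPotVec σ c y := by
  rw [EuclideanSpace.real_norm_sq_eq, Finset.mul_sum]
  refine Finset.sum_le_sum fun i _ => ?_
  have h1 := min_le_satPot (hd i) hd0 (y i)
  have h2 := div_mul_sq_le_min hd0 hρ (hy i)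
  rw [PiLp.sub_apply]
  linarith

theorem inner_satVec_sub_ge (hd : ∀ i, d ≤ σ - |c i|) (hd0 : 0 < d) {ρ : ℝ} (hρ : d ≤ ρ)
    {y : E3} (hy : ∀ i, |y i - c i| ≤ ρ) :
    d / ρ * ‖y - c‖ ^ 2 ≤ inner ℝ (satVec σ y - c) (y - c) := by
  rw [EuclideanSpace.real_norm_sq_eq, Finset.mul_sum, PiLp.inner_apply]
  refine Finset.sum_le_sum fun i _ => ?_
  have h1 := min_le_sat_mul (hd i) hd0 (y i)
  have h2 := div_mul_sq_le_min hd0 hρ (hy i)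
  simp only [PiLp.sub_apply, satVec, RCLike.inner_apply, conj_trivial]
  linarith

/-! ### Decay of functions along a differential inequality -/

theorem le_of_derivWithin_nonpos {f : ℝ → ℝ} {t₀ T τ : ℝ} (hτ : τ ∈ Set.Ico t₀ T)
    (hf : ∀ t ∈ Set.Icc t₀ τ, ∃ f', HasDerivWithinAt f f' (Set.Ico t₀ T) t ∧ f' ≤ 0) :
    f τ ≤ f t₀ := by
  have hsub : Set.Icc t₀ τ ⊆ Set.Ico t₀ T := fun t ht => ⟨ht.1, ht.2.trans_lt hτ.2⟩
  have hd : ∀ t ∈ Set.Ioo t₀ τ, ∃ f', HasDerivAt f f' t ∧ f' ≤ 0 := by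
    intro t ht
    obtain ⟨f', h1, h2⟩ := hf t (Set.Ioo_subset_Icc_self ht)
    exact ⟨f', h1.hasDerivAt (Ico_mem_nhds ht.1 (ht.2.trans hτ.2)), h2⟩
  refine antitoneOn_of_deriv_nonpos (convex_Icc t₀ τ) (fun t ht => ?_) ?_ ?_
    (Set.left_mem_Icc.2 hτ.1) (Set.right_mem_Icc.2 hτ.1) hτ.1
  · obtain ⟨f', h1, -⟩ := hf t ht
    exact h1.continuousWithinAt.mono hsub
  · rw [interior_Icc]
    intro t ht
    obtain ⟨f', h1, -⟩ := hd t ht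
    exact h1.differentiableAt.differentiableWithinAt
  · rw [interior_Icc]
    intro t ht
    obtain ⟨f', h1, h2⟩ := hd t ht
    rwa [h1.deriv]

theorem le_exp_of_derivWithin_le {f : ℝ → ℝ} {t₀ T τ γ : ℝ} (hτ : τ ∈ Set.Ico t₀ T)
    (hf : ∀ t ∈ Set.Icc t₀ τ, ∃ f', HasDerivWithinAt f f' (Set.Ico t₀ T) t ∧ f' ≤ -γ * f t) :
    f τ ≤ f t₀ * Real.exp (-γ * (τ - t₀)) := by
  have h := le_of_derivWithin_nonpos (f := fun t => f t * Real.exp (γ * (t - t₀))) hτ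
    fun t ht => by
      obtain ⟨f', h1, h2⟩ := hf t ht
      have he : HasDerivAt (fun t => Real.exp (γ * (t - t₀))) (Real.exp (γ * (t - t₀)) * (γ * 1)) t :=
        (((hasDerivAt_id t).sub_const t₀).const_mul γ).exp
      refine ⟨_, h1.mul he.hasDerivWithinAt, ?_⟩
      have := Real.exp_pos (γ * (t - t₀))
      nlinarith
  simp only [sub_self, mul_zero, Real.exp_zero, mul_one] at h
  have h2 := mul_le_mul_of_nonneg_right h (Real.exp_pos (-γ * (τ - t₀))).le
  rwa [mul_assoc, ← Real.exp_add, show γ * (τ - t₀) + -γ * (τ - t₀) = 0 by ring, Real.exp_zero,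
    mul_one] at h2

/-- A Lyapunov function `U` that dissipates only the part `q` of the state, corrected by a small
multiple of a cross term `D` that dissipates the remaining part `i`, yields exponential decay. -/
theorem exp_decay_of_cross_term {lam κ K N μ M : ℝ} (hlam : 0 < lam) (hκ : 0 < κ) (hK : 0 < K)
    (hN : 0 < N) (hμ : 0 < μ) (hM : 0 < M) :
    ∃ C > 0, ∃ γ > 0, ∀ (t₀ T τ : ℝ) (U D q i : ℝ → ℝ), τ ∈ Set.Ico t₀ T →
      (∀ t ∈ Set.Icc t₀ τ, 0 ≤ q t ∧ 0 ≤ i t ∧ μ * (q t + i t) ≤ U t ∧ U t ≤ M * (q t + i t) ∧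
        |D t| ≤ N * (q t + i t) ∧
        (∃ U', HasDerivWithinAt U U' (Set.Ico t₀ T) t ∧ U' ≤ -lam * q t) ∧
        ∃ D', HasDerivWithinAt D D' (Set.Ico t₀ T) t ∧ D' ≤ -κ * i t + K * q t) →
      q τ + i τ ≤ C * (q t₀ + i t₀) * Real.exp (-γ * (τ - t₀)) := by
  -- The first entry keeps `U + ε * D` between μ/2 and M + μ/2 times q + i; the second lets half of
  -- the dissipation of `q` absorb the cost `ε * K` of the cross term.
  set ε := min (μ / (2 * N)) (lam / (2 * K)) with hε
  have hε0 : 0 < ε := lt_min (by positivity) (by positivity)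
  have hεN : ε * N ≤ μ / 2 := by
    have : ε ≤ μ / (2 * N) := min_le_left _ _
    rw [le_div_iff₀ (by positivity)] at this
    linarith
  have hεK : ε * K ≤ lam / 2 := by
    have : ε ≤ lam / (2 * K) := min_le_right _ _
    rw [le_div_iff₀ (by positivity)] at this
    linarith
  set g := min (lam / 2) (ε * κ) with hg
  have hg0 : 0 < g := lt_min (by positivity) (by positivity)
  have hg1 : g ≤ lam / 2 := min_le_left _ _
  have hg2 : g ≤ ε * κ := min_le_right _ _
  have hM' : 0 < M + μ / 2 := by positivity
  refine ⟨2 / μ * (M + μ / 2), by positivity, g / (M + μ / 2), by positivity, ?_⟩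
  intro t₀ T τ U D q i hτ h
  have hW : ∀ t ∈ Set.Icc t₀ τ, μ / 2 * (q t + i t) ≤ U t + ε * D t ∧
      U t + ε * D t ≤ (M + μ / 2) * (q t + i t) := by
    intro t ht
    obtain ⟨h1, h2, h3, h4, h5, -⟩ := h t ht
    obtain ⟨h6, h7⟩ := abs_le.1 h5
    have h8 := mul_le_mul_of_nonneg_left h6 hε0.le
    have h9 := mul_le_mul_of_nonneg_left h7 hε0.le
    have h10 := mul_le_mul_of_nonneg_right hεN (add_nonneg h1 h2)
    constructor <;> nlinarith
  have h0 : t₀ ∈ Set.Icc t₀ τ := Set.left_mem_Icc.2 hτ.1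
  have h1 : τ ∈ Set.Icc t₀ τ := Set.right_mem_Icc.2 hτ.1
  have hexp := le_exp_of_derivWithin_le (f := fun t => U t + ε * D t)
    (γ := g / (M + μ / 2)) hτ fun t ht => by
      obtain ⟨h1, h2, -, -, -, ⟨U', h3, h4⟩, D', h5, h6⟩ := h t ht
      refine ⟨_, h3.add (h5.const_mul ε), ?_⟩
      have h7 := (hW t ht).2
      have h8 : g / (M + μ / 2) * (U t + ε * D t) ≤ g * (q t + i t) := by
        rw [div_mul_eq_mul_div, div_le_iff₀ hM']
        nlinarith
      have h9 := mul_le_mul_of_nonneg_left h6 hε0.le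
      have h10 := mul_le_mul_of_nonneg_right hεK h1
      have h11 := mul_le_mul_of_nonneg_right hg1 h1
      have h12 := mul_le_mul_of_nonneg_right hg2 h2
      linarith
  have h2 := (hW τ h1).1
  have h3 := mul_le_mul_of_nonneg_right (hW t₀ h0).2
    (Real.exp_pos (-(g / (M + μ / 2)) * (τ - t₀))).le
  calc q τ + i τ = 2 / μ * (μ / 2 * (q τ + i τ)) := by field_simp
    _ ≤ 2 / μ * ((M + μ / 2) * (q t₀ + i t₀) * Real.exp (-(g / (M + μ / 2)) * (τ - t₀))) :=
      mul_le_mul_of_nonneg_left (h2.trans (hexp.trans h3)) (by positivity)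
    _ = _ := by ring

/-! ### Scalar inequalities -/

theorem young {ε : ℝ} (hε : 0 < ε) (u v : ℝ) : u * v ≤ ε * u ^ 2 + 1 / (4 * ε) * v ^ 2 := by
  have h : ε * u ^ 2 + 1 / (4 * ε) * v ^ 2 - u * v = ε * (u - v / (2 * ε)) ^ 2 := by
    field_simp
    ring
  have : 0 ≤ ε * (u - v / (2 * ε)) ^ 2 := by positivity
  linarith

/-- Determinant over trace is a lower bound for the smaller eigenvalue; after multiplication by the
trace the difference is (ax - by)² + (bx - cy)². -/
theorem exists_pos_quadratic {a b c : ℝ} (ha : 0 < a) (hc : 0 < c) (h : b ^ 2 < a * c) :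
    ∃ lam > 0, ∀ x y : ℝ, lam * (x ^ 2 + y ^ 2) ≤ a * x ^ 2 - 2 * b * (x * y) + c * y ^ 2 := by
  refine ⟨(a * c - b ^ 2) / (a + c), div_pos (by linarith) (by linarith), fun x y => ?_⟩
  rw [div_mul_eq_mul_div, div_le_iff₀ (by linarith)]
  nlinarith [sq_nonneg (a * x - b * y), sq_nonneg (b * x - c * y)]

theorem sq_add_three_le (a b c x y z : ℝ) :
    (2 * a * x + 2 * b * y + c * z) ^ 2
      ≤ (12 * a ^ 2 + 12 * b ^ 2 + 3 * c ^ 2) * (x ^ 2 + y ^ 2 + z ^ 2) := by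
  have : (2 * a * x + 2 * b * y + c * z) ^ 2
      ≤ 12 * a ^ 2 * x ^ 2 + 12 * b ^ 2 * y ^ 2 + 3 * c ^ 2 * z ^ 2 := by
    linarith [sq_nonneg (2 * a * x - 2 * b * y), sq_nonneg (2 * a * x - c * z),
      sq_nonneg (2 * b * y - c * z)]
  refine this.trans ?_
  have z1 : 0 ≤ a ^ 2 * (y ^ 2 + z ^ 2) := by positivity
  have z2 : 0 ≤ b ^ 2 * (x ^ 2 + z ^ 2) := by positivity
  have z3 : 0 ≤ c ^ 2 * (x ^ 2 + y ^ 2) := by positivity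
  linarith

theorem neg_mul_norm_le_inner (x y : E3) : -(‖x‖ * ‖y‖) ≤ inner ℝ x y :=
  (abs_le.1 (abs_real_inner_le_norm x y)).1

/-! ### The position subsystem -/

/-- The Lyapunov function of the position errors. -/
noncomputable def posLyap (p : Params) (c x v e : E3) : ℝ :=
  p.kx / 2 * ‖x‖ ^ 2 + p.m / 2 * ‖v‖ ^ 2 + p.m * p.c1 * inner ℝ x v + p.ki * satPotVec p.σ c e

/-- The rate of `posLyap` for the acceleration error `a`. -/
noncomputable def posRate (p : Params) (c x v e a : E3) : ℝ :=
  p.kx * inner ℝ x v + p.m * inner ℝ v a + p.m * p.c1 * (inner ℝ x a + inner ℝ v v)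
    + p.ki * inner ℝ (satVec p.σ e - c) (v + p.c1 • x)

theorem hasDerivWithinAt_posLyap {p : Params} (hσ : 0 < p.σ) (c : E3) {x v e : ℝ → E3} {a : E3}
    {I : Set ℝ} {t : ℝ} (hx : HasDerivWithinAt x (v t) I t) (hv : HasDerivWithinAt v a I t)
    (he : HasDerivWithinAt e (v t + p.c1 • x t) I t) :
    HasDerivWithinAt (fun τ => posLyap p c (x τ) (v τ) (e τ))
      (posRate p c (x t) (v t) (e t) a) I t := by
  unfold posLyap posRate
  have h := (((hx.norm_sq.const_mul (p.kx / 2)).add (hv.norm_sq.const_mul (p.m / 2))).add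
    ((hx.inner ℝ hv).const_mul (p.m * p.c1))).add
    ((hasDerivWithinAt_satPotVec hσ c he).const_mul p.ki)
  refine h.congr_deriv ?_
  ring

/-- The position error dynamics cancel the integral action in the rate of `posLyap`. -/
theorem posRate_eq {p : Params} {c x v e a X : E3}
    (ha : p.m • a = -(p.kx • x) - p.kv • v - p.ki • (satVec p.σ e - c) + X) :
    posRate p c x v e a = -(p.kv - p.m * p.c1) * ‖v‖ ^ 2 - p.c1 * p.kx * ‖x‖ ^ 2
      - p.c1 * p.kv * inner ℝ x v + inner ℝ v X + p.c1 * inner ℝ x X := by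
  have h : ∀ y : E3, p.m * inner ℝ y a
      = -(p.kx * inner ℝ y x) - p.kv * inner ℝ y v
        - p.ki * inner ℝ y (satVec p.σ e - c) + inner ℝ y X := by
    intro y
    rw [← real_inner_smul_right, ha]
    simp only [inner_add_right, inner_sub_right, inner_neg_right, inner_smul_right]
  unfold posRate
  rw [mul_add, h v, show p.m * p.c1 * inner ℝ x a = p.c1 * (p.m * inner ℝ x a) by ring, h x,
    inner_add_right, inner_smul_right, real_inner_comm v x, real_inner_self_eq_norm_sq,
    real_inner_self_eq_norm_sq, real_inner_comm (satVec p.σ e - c) x,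
    real_inner_comm (satVec p.σ e - c) v]
  ring

section Position

variable {p : Params}

/-- The parts of X linear in e_x and e_v carry a factor ‖n‖ ≤ α. Most are absorbed into a quadratic
form with matrix W_1, and the bound on c_1 is exactly positivity of its determinant. The rest is
handled by Young's inequality, leaving a multiple of ‖n‖² for the attitude to pay. -/
theorem exists_posRate_le {F exmax α : ℝ} (hm : 0 < p.m) (hkx : 0 < p.kx) (hkv : 0 < p.kv)
    (hc1 : 0 < p.c1) (hα0 : 0 ≤ α) (hα1 : α < 1)
    (hgain : p.c1 < 4 * p.kx * p.kv * (1 - α) ^ 2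
      / (p.kv ^ 2 * (1 + α) ^ 2 + 4 * p.m * p.kx * (1 - α))) :
    ∃ lam > 0, ∃ K > 0, ∀ c x v e a X n : E3,
      p.m • a = -(p.kx • x) - p.kv • v - p.ki • (satVec p.σ e - c) + X →
      ‖X‖ ≤ (p.kx * ‖x‖ + p.kv * ‖v‖ + F) * ‖n‖ → ‖n‖ ≤ α → ‖x‖ ≤ exmax →
      posRate p c x v e a ≤ -lam * (‖x‖ ^ 2 + ‖v‖ ^ 2) + K * ‖n‖ ^ 2 := by
  have hα2 : 0 < 1 - α := by linarith
  rw [lt_div_iff₀ (by positivity)] at hgain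
  have hmc : 0 < p.kv * (1 - α) - p.m * p.c1 := by
    have h1 : 0 < 4 * p.kx * (1 - α) * (p.kv * (1 - α) - p.m * p.c1) := by
      nlinarith [show 0 ≤ p.c1 * (p.kv ^ 2 * (1 + α) ^ 2) by positivity]
    exact pos_of_mul_pos_right h1 (by positivity)
  obtain ⟨lam, hlam, hq⟩ := exists_pos_quadratic (a := p.c1 * p.kx * (1 - α))
    (b := p.c1 * p.kv * (1 + α) / 2) (c := p.kv * (1 - α) - p.m * p.c1) (by positivity) hmc
    (by nlinarith [mul_lt_mul_of_pos_left hgain hc1])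
  -- `P` and `Q` are the coefficients of ‖v‖‖n‖ and ‖x‖‖n‖ left over. The product k_x‖x‖‖v‖‖n‖ goes
  -- into `P` through ‖x‖ ≤ exmax, which is where the position bound is needed.
  set P := p.kx * exmax + F with hP
  set Q := p.c1 * F with hQ
  refine ⟨lam / 2, by positivity, 1 / (4 * (lam / 2)) * (P ^ 2 + Q ^ 2) + 1, by positivity, ?_⟩
  intro c x v e a X n ha hX hn hx
  rw [posRate_eq ha]
  have h1 := neg_mul_norm_le_inner x v
  have h2 := real_inner_le_norm v X
  have h3 := real_inner_le_norm x X
  have h4 := mul_le_mul_of_nonneg_left hX (norm_nonneg v)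
  have h5 := mul_le_mul_of_nonneg_left hX (norm_nonneg x)
  have hq' := hq ‖x‖ ‖v‖
  have y1 := young (half_pos hlam) ‖v‖ (P * ‖n‖)
  have y2 := young (half_pos hlam) ‖x‖ (Q * ‖n‖)
  clear_value P Q
  set ξ := ‖x‖
  set ν := ‖v‖
  set k := ‖n‖
  have hξ : 0 ≤ ξ := norm_nonneg _
  have hν : 0 ≤ ν := norm_nonneg _
  have hk : 0 ≤ k := norm_nonneg _
  have e1 : p.kv * ν ^ 2 * k ≤ p.kv * ν ^ 2 * α := mul_le_mul_of_nonneg_left hn (by positivity)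
  have e2 : p.c1 * p.kx * ξ ^ 2 * k ≤ p.c1 * p.kx * ξ ^ 2 * α :=
    mul_le_mul_of_nonneg_left hn (by positivity)
  have e3 : p.c1 * p.kv * (ξ * ν) * k ≤ p.c1 * p.kv * (ξ * ν) * α :=
    mul_le_mul_of_nonneg_left hn (by positivity)
  have e4 : p.kx * (ν * k) * ξ ≤ p.kx * (ν * k) * exmax :=
    mul_le_mul_of_nonneg_left hx (by positivity)
  have e5 : p.c1 * p.kv * -(ξ * ν) ≤ p.c1 * p.kv * inner ℝ x v :=
    mul_le_mul_of_nonneg_left h1 (by positivity)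
  have e6 : p.c1 * inner ℝ x X ≤ p.c1 * (ξ * ((p.kx * ξ + p.kv * ν + F) * k)) :=
    mul_le_mul_of_nonneg_left (h3.trans h5) hc1.le
  have e7 : inner ℝ v X ≤ ν * ((p.kx * ξ + p.kv * ν + F) * k) := h2.trans h4
  have e8 : ν * (P * k) = p.kx * (ν * k) * exmax + F * ν * k := by rw [hP]; ring
  have e9 : ξ * (Q * k) = p.c1 * F * ξ * k := by rw [hQ]; ring
  nlinarith [sq_nonneg k]

/-- The rate of the cross term `m η ⬝ v` that makes the integral action dissipative. -/
theorem exists_posCross_le {F a₀ : ℝ} (hm : 0 < p.m) (hkx : 0 < p.kx) (hkv : 0 < p.kv)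
    (hki : 0 < p.ki) (hc1 : 0 < p.c1) (ha₀ : 0 < a₀) :
    ∃ K > 0, ∀ c x v e a X n : E3,
      p.m • a = -(p.kx • x) - p.kv • v - p.ki • (satVec p.σ e - c) + X →
      ‖X‖ ≤ (p.kx * ‖x‖ + p.kv * ‖v‖ + F) * ‖n‖ → ‖n‖ ≤ 1 →
      a₀ * ‖e - c‖ ^ 2 ≤ inner ℝ (satVec p.σ e - c) (e - c) →
      p.m * (inner ℝ (e - c) a + inner ℝ (v + p.c1 • x) v)
        ≤ -(p.ki * a₀ / 2) * ‖e - c‖ ^ 2 + K * (‖x‖ ^ 2 + ‖v‖ ^ 2 + ‖n‖ ^ 2) := by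
  set g := p.ki * a₀ / 2 with hg
  have hg0 : 0 < g := by positivity
  refine ⟨p.m + p.m * p.c1 + 1 / (4 * g) * (12 * p.kx ^ 2 + 12 * p.kv ^ 2 + 3 * F ^ 2),
    by positivity, ?_⟩
  intro c x v e a X n ha hX hn hs
  have h0 : p.m * inner ℝ (e - c) a = -(p.kx * inner ℝ (e - c) x) - p.kv * inner ℝ (e - c) v
        - p.ki * inner ℝ (satVec p.σ e - c) (e - c) + inner ℝ (e - c) X := by
    rw [← real_inner_smul_right, ha, real_inner_comm (e - c) (satVec p.σ e - c)]
    simp only [inner_add_right, inner_sub_right, inner_neg_right, inner_smul_right]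
  rw [mul_add, h0, inner_add_left, inner_smul_left, real_inner_self_eq_norm_sq]
  simp only [conj_trivial]
  have h1 := mul_le_mul_of_nonneg_left (neg_mul_norm_le_inner (e - c) x) hkx.le
  have h2 := mul_le_mul_of_nonneg_left (neg_mul_norm_le_inner (e - c) v) hkv.le
  have h3 := real_inner_le_norm (e - c) X
  have h4 := mul_le_mul_of_nonneg_left (real_inner_le_norm x v) (mul_pos hm hc1).le
  have h5 := mul_le_mul_of_nonneg_left hs hki.le
  have hX' : ‖X‖ ≤ p.kx * ‖x‖ + p.kv * ‖v‖ + F * ‖n‖ := by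
    have : (p.kx * ‖x‖ + p.kv * ‖v‖) * ‖n‖ ≤ (p.kx * ‖x‖ + p.kv * ‖v‖) * 1 :=
      mul_le_mul_of_nonneg_left hn (by positivity)
    linarith
  have h6 := mul_le_mul_of_nonneg_left hX' (norm_nonneg (e - c))
  -- The factors 2 count the feedback terms once and the same terms in the bound of X once more;
  -- Young spends half of the available k_i a₀‖e - c‖².
  have y := young hg0 ‖e - c‖ (2 * p.kx * ‖x‖ + 2 * p.kv * ‖v‖ + F * ‖n‖)
  have h7 := sq_add_three_le p.kx p.kv F ‖x‖ ‖v‖ ‖n‖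
  have h8 := mul_le_mul_of_nonneg_left h7 (by positivity : 0 ≤ 1 / (4 * g))
  have h9 : p.m * p.c1 * (‖x‖ * ‖v‖) ≤ p.m * p.c1 * (‖x‖ ^ 2 + ‖v‖ ^ 2 + ‖n‖ ^ 2) := by
    refine mul_le_mul_of_nonneg_left ?_ (by positivity)
    nlinarith [sq_nonneg (‖x‖ - ‖v‖), sq_nonneg ‖x‖, sq_nonneg ‖v‖, sq_nonneg ‖n‖]
  have h10 : p.m * ‖v‖ ^ 2 ≤ p.m * (‖x‖ ^ 2 + ‖v‖ ^ 2 + ‖n‖ ^ 2) :=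
    mul_le_mul_of_nonneg_left (by nlinarith [sq_nonneg ‖x‖, sq_nonneg ‖n‖]) hm.le
  have h11 : p.ki * (a₀ * ‖e - c‖ ^ 2) = 2 * g * ‖e - c‖ ^ 2 := by rw [hg]; ring
  have h12 : ‖e - c‖ * (2 * p.kx * ‖x‖ + 2 * p.kv * ‖v‖ + F * ‖n‖)
      = p.kx * (‖e - c‖ * ‖x‖) + p.kv * (‖e - c‖ * ‖v‖)
        + ‖e - c‖ * (p.kx * ‖x‖ + p.kv * ‖v‖ + F * ‖n‖) := by ring
  rw [add_mul, add_mul, mul_assoc (1 / (4 * g))]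
  linarith

/-- The condition c_1² < k_x/m is positive definiteness of the form k_x/2, m c_1/2, m/2 in (‖x‖,
‖v‖). -/
theorem exists_le_posLyap (hm : 0 < p.m) (hkx : 0 < p.kx) (hc1 : 0 < p.c1)
    (hgain : p.c1 < √(p.kx / p.m)) :
    ∃ μ > 0, ∀ c x v e : E3,
      μ * (‖x‖ ^ 2 + ‖v‖ ^ 2) + p.ki * satPotVec p.σ c e ≤ posLyap p c x v e := by
  have h1 : p.c1 ^ 2 < p.kx / p.m := (Real.lt_sqrt hc1.le).1 hgain
  rw [lt_div_iff₀ hm] at h1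
  obtain ⟨lam, hlam, hq⟩ := exists_pos_quadratic (a := p.kx / 2) (b := p.m * p.c1 / 2)
    (c := p.m / 2) (by positivity) (by positivity)
    (by nlinarith [mul_lt_mul_of_pos_left h1 hm])
  refine ⟨lam, hlam, fun c x v e => ?_⟩
  have h2 := mul_le_mul_of_nonneg_left (neg_mul_norm_le_inner x v) (mul_pos hm hc1).le
  have h3 := hq ‖x‖ ‖v‖
  unfold posLyap
  linarith

theorem exists_posLyap_le (hm : 0 < p.m) (hkx : 0 < p.kx) (hki : 0 < p.ki) (hc1 : 0 < p.c1) :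
    ∃ M > 0, ∀ c x v e : E3, posLyap p c x v e ≤ M * (‖x‖ ^ 2 + ‖v‖ ^ 2 + ‖e - c‖ ^ 2) := by
  refine ⟨p.kx + p.m + p.m * p.c1 + p.ki, by positivity, fun c x v e => ?_⟩
  have h1 := mul_le_mul_of_nonneg_left (real_inner_le_norm x v) (mul_pos hm hc1).le
  have h2 := mul_le_mul_of_nonneg_left (satPotVec_le p.σ c e) hki.le
  have h3 : p.m * p.c1 * (‖x‖ * ‖v‖) ≤ p.m * p.c1 * (‖x‖ ^ 2 + ‖v‖ ^ 2) :=
    mul_le_mul_of_nonneg_left (by nlinarith [sq_nonneg (‖x‖ - ‖v‖), sq_nonneg ‖x‖, sq_nonneg ‖v‖])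
      (by positivity)
  have z1 : 0 ≤ p.kx * (‖x‖ ^ 2 + 2 * ‖v‖ ^ 2 + 2 * ‖e - c‖ ^ 2) := by positivity
  have z2 : 0 ≤ p.m * (2 * ‖x‖ ^ 2 + ‖v‖ ^ 2 + 2 * ‖e - c‖ ^ 2) := by positivity
  have z3 : 0 ≤ p.m * p.c1 * ‖e - c‖ ^ 2 := by positivity
  have z4 : 0 ≤ p.ki * (2 * ‖x‖ ^ 2 + 2 * ‖v‖ ^ 2 + ‖e - c‖ ^ 2) := by positivity
  unfold posLyap
  linarith

end Position

/-! ### The attitude subsystem -/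

/-- The Lyapunov function of the attitude errors; `η` is the integral term relative to its
equilibrium. -/
noncomputable def attLyap (p : Params) (n w η : E3) (Ψ : ℝ) : ℝ :=
  1 / 2 * inner ℝ w (act p.J w) + p.kR * Ψ + p.c2 * inner ℝ n (act p.J w) + p.kI / 2 * ‖η‖ ^ 2

/-- The rate of `attLyap`, where `ρ` is the rate of `n` and `b` the rate of `J w`. -/
noncomputable def attRate (p : Params) (n w η ρ b : E3) : ℝ :=
  inner ℝ w b + p.kR * inner ℝ n w + p.c2 * (inner ℝ n b + inner ℝ ρ (act p.J w))
    + p.kI * inner ℝ η (w + p.c2 • n)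

theorem hasDerivWithinAt_act (J : M3) {w : ℝ → E3} {w' : E3} {I : Set ℝ} {t : ℝ}
    (hw : HasDerivWithinAt w w' I t) :
    HasDerivWithinAt (fun τ => act J (w τ)) (act J w') I t :=
  (Matrix.toEuclideanCLM (n := Fin 3) (𝕜 := ℝ) J).hasFDerivAt.comp_hasDerivWithinAt t hw

theorem hasDerivWithinAt_attLyap {p : Params} (hJ : p.Jᵀ = p.J) {n w η : ℝ → E3} {Ψ : ℝ → ℝ}
    {ρ w' : E3} {I : Set ℝ} {t : ℝ} (hn : HasDerivWithinAt n ρ I t)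
    (hw : HasDerivWithinAt w w' I t) (hη : HasDerivWithinAt η (w t + p.c2 • n t) I t)
    (hΨ : HasDerivWithinAt Ψ (inner ℝ (n t) (w t)) I t) :
    HasDerivWithinAt (fun τ => attLyap p (n τ) (w τ) (η τ) (Ψ τ))
      (attRate p (n t) (w t) (η t) ρ (act p.J w')) I t := by
  unfold attLyap attRate
  have hJw := hasDerivWithinAt_act p.J hw
  have h := ((((hw.inner ℝ hJw).const_mul (1 / 2)).add (hΨ.const_mul p.kR)).add
    ((hn.inner ℝ hJw).const_mul p.c2)).add (hη.norm_sq.const_mul (p.kI / 2))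
  refine h.congr_deriv ?_
  rw [← inner_act_comm hJ w' (w t), real_inner_comm (w t) (act p.J w')]
  ring

section Attitude

variable {p : Params}

/-- The gyroscopic term is orthogonal to w, and the k_R and k_I couplings cancel, so the rate is
bounded by minus the form of W_2. The bound on c_2 is positivity of its determinant. -/
theorem exists_attRate_le {B : ℝ} (hJ : p.J.PosDef) (hkR : 0 < p.kR) (hkΩ : 0 < p.kΩ)
    (hc2 : 0 < p.c2)
    (hgain : p.c2 < 4 * p.kR * p.kΩ / (8 * p.kR * maxEig p.J + (p.kΩ + B) ^ 2)) :
    ∃ lam > 0, ∀ n w η ρ d b : E3,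
      b = cross (act p.J w + d) w - p.kR • n - p.kΩ • w - p.kI • η →
      ‖ρ‖ ≤ ‖w‖ → ‖d‖ ≤ B → ‖n‖ ≤ 1 →
      attRate p n w η ρ b ≤ -lam * (‖n‖ ^ 2 + ‖w‖ ^ 2) := by
  have hL := maxEig_pos hJ
  rw [lt_div_iff₀ (by positivity)] at hgain
  have hmc : 0 < p.kΩ - 2 * p.c2 * maxEig p.J := by
    have h1 : 0 < 4 * p.kR * (p.kΩ - 2 * p.c2 * maxEig p.J) := by
      nlinarith [mul_nonneg hc2.le (sq_nonneg (p.kΩ + B))]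
    exact pos_of_mul_pos_right h1 (by positivity)
  obtain ⟨lam, hlam, hq⟩ := exists_pos_quadratic (a := p.c2 * p.kR)
    (b := p.c2 * (p.kΩ + B) / 2) (c := p.kΩ - 2 * p.c2 * maxEig p.J) (by positivity) hmc
    (by nlinarith [mul_lt_mul_of_pos_left hgain hc2])
  refine ⟨lam, hlam, ?_⟩
  intro n w η ρ d b hb hρ hd hn
  have hJw := norm_act_le_maxEig hJ w
  have e1 : attRate p n w η ρ b = -p.kΩ * ‖w‖ ^ 2 - p.c2 * p.kR * ‖n‖ ^ 2
      - p.c2 * p.kΩ * inner ℝ n w + p.c2 * inner ℝ n (cross (act p.J w + d) w)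
      + p.c2 * inner ℝ ρ (act p.J w) := by
    unfold attRate
    rw [hb]
    simp only [inner_add_right, inner_sub_right, inner_smul_right, inner_cross_self,
      real_inner_self_eq_norm_sq]
    rw [real_inner_comm n w, real_inner_comm w η, real_inner_comm n η]
    ring
  rw [e1]
  have h1 := mul_le_mul_of_nonneg_left (neg_mul_norm_le_inner n w) (mul_pos hc2 hkΩ).le
  -- This bound and the next each contribute one λ_M(J)‖w‖², which accounts for the 2 c_2 λ_M(J) in
  -- W_2.
  have h2 : inner ℝ ρ (act p.J w) ≤ maxEig p.J * ‖w‖ ^ 2 := by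
    refine (real_inner_le_norm _ _).trans ?_
    calc ‖ρ‖ * ‖act p.J w‖ ≤ ‖w‖ * (maxEig p.J * ‖w‖) := by gcongr
      _ = _ := by ring
  have h3 : inner ℝ n (cross (act p.J w + d) w)
      ≤ maxEig p.J * ‖w‖ ^ 2 + B * (‖n‖ * ‖w‖) := by
    refine (real_inner_le_norm _ _).trans ?_
    calc ‖n‖ * ‖cross (act p.J w + d) w‖ ≤ ‖n‖ * ((maxEig p.J * ‖w‖ + B) * ‖w‖) := by
          gcongr
          refine (norm_cross_le _ _).trans ?_
          gcongr
          exact (norm_add_le _ _).trans (add_le_add hJw hd)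
      _ = ‖n‖ * (maxEig p.J * ‖w‖ ^ 2) + B * (‖n‖ * ‖w‖) := by ring
      _ ≤ 1 * (maxEig p.J * ‖w‖ ^ 2) + B * (‖n‖ * ‖w‖) := by gcongr
      _ = _ := by ring
  have h4 := mul_le_mul_of_nonneg_left h2 hc2.le
  have h5 := mul_le_mul_of_nonneg_left h3 hc2.le
  have h6 := hq ‖n‖ ‖w‖
  linarith

/-- The rate of the cross term `η ⬝ J w` that makes the integral action dissipative. -/
theorem exists_attCross_le {B r : ℝ} (hJ : p.J.PosDef) (hkR : 0 < p.kR) (hkΩ : 0 < p.kΩ)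
    (hkI : 0 < p.kI) (hc2 : 0 < p.c2) (hB : 0 ≤ B) (hr : 0 ≤ r) :
    ∃ K > 0, ∀ n w η d b : E3,
      b = cross (act p.J w + d) w - p.kR • n - p.kΩ • w - p.kI • η →
      ‖d‖ ≤ B → ‖η‖ ≤ r →
      inner ℝ η b + inner ℝ (w + p.c2 • n) (act p.J w)
        ≤ -(p.kI / 2) * ‖η‖ ^ 2 + K * (‖n‖ ^ 2 + ‖w‖ ^ 2) := by
  have hL := maxEig_pos hJ
  set L := maxEig p.J with hLdef
  have hg : 0 < p.kI / 2 := by positivity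
  refine ⟨r * L + L + p.c2 * L + 1 / (4 * (p.kI / 2)) * (2 * p.kR ^ 2 + 2 * (p.kΩ + B) ^ 2),
    by positivity, ?_⟩
  intro n w η d b hb hd hη
  have hJw := norm_act_le_maxEig hJ w
  rw [← hLdef] at hJw
  have e1 : inner ℝ η b = inner ℝ η (cross (act p.J w + d) w) - p.kR * inner ℝ η n
      - p.kΩ * inner ℝ η w - p.kI * ‖η‖ ^ 2 := by
    rw [hb]
    simp only [inner_sub_right, inner_smul_right, real_inner_self_eq_norm_sq]
  rw [e1, inner_add_left, inner_smul_left]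
  simp only [conj_trivial]
  have h1 := mul_le_mul_of_nonneg_left (neg_mul_norm_le_inner η n) hkR.le
  have h2 := mul_le_mul_of_nonneg_left (neg_mul_norm_le_inner η w) hkΩ.le
  -- The term cubic in (η, w) becomes quadratic only through the a priori bound `r` on ‖η‖.
  have h3 : inner ℝ η (cross (act p.J w + d) w) ≤ r * L * ‖w‖ ^ 2 + B * (‖η‖ * ‖w‖) := by
    refine (real_inner_le_norm _ _).trans ?_
    calc ‖η‖ * ‖cross (act p.J w + d) w‖ ≤ ‖η‖ * ((L * ‖w‖ + B) * ‖w‖) := by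
          gcongr
          refine (norm_cross_le _ _).trans ?_
          gcongr
          exact (norm_add_le _ _).trans (add_le_add hJw hd)
      _ = ‖η‖ * (L * ‖w‖ ^ 2) + B * (‖η‖ * ‖w‖) := by ring
      _ ≤ r * (L * ‖w‖ ^ 2) + B * (‖η‖ * ‖w‖) := by gcongr
      _ = _ := by ring
  have h4 : inner ℝ w (act p.J w) ≤ L * ‖w‖ ^ 2 := by
    refine (real_inner_le_norm _ _).trans ?_
    calc ‖w‖ * ‖act p.J w‖ ≤ ‖w‖ * (L * ‖w‖) := by gcongr
      _ = _ := by ring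
  have h5 : inner ℝ n (act p.J w) ≤ L * (‖n‖ ^ 2 + ‖w‖ ^ 2) := by
    refine (real_inner_le_norm _ _).trans ?_
    calc ‖n‖ * ‖act p.J w‖ ≤ ‖n‖ * (L * ‖w‖) := by gcongr
      _ = L * (‖n‖ * ‖w‖) := by ring
      _ ≤ _ := by
        gcongr
        nlinarith [sq_nonneg (‖n‖ - ‖w‖), sq_nonneg ‖n‖, sq_nonneg ‖w‖]
  have h6 := mul_le_mul_of_nonneg_left h5 hc2.le
  have y := young hg ‖η‖ (p.kR * ‖n‖ + (p.kΩ + B) * ‖w‖)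
  have h7 : (p.kR * ‖n‖ + (p.kΩ + B) * ‖w‖) ^ 2
      ≤ (2 * p.kR ^ 2 + 2 * (p.kΩ + B) ^ 2) * (‖n‖ ^ 2 + ‖w‖ ^ 2) := by
    have z1 : 0 ≤ p.kR ^ 2 * ‖w‖ ^ 2 := by positivity
    have z2 : 0 ≤ (p.kΩ + B) ^ 2 * ‖n‖ ^ 2 := by positivity
    linarith [sq_nonneg (p.kR * ‖n‖ - (p.kΩ + B) * ‖w‖)]
  have h8 := mul_le_mul_of_nonneg_left h7 (by positivity : 0 ≤ 1 / (4 * (p.kI / 2)))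
  have z1 : 0 ≤ (r * L + L) * ‖n‖ ^ 2 := by positivity
  linarith

/-- Since ‖n‖² = Ψ(2 - Ψ) ≤ 2Ψ, the potential k_R Ψ dominates k_R‖n‖²/2, and the first bound on c_2
makes the form in (‖n‖, ‖w‖) positive definite. -/
theorem exists_le_attLyap (hJ : p.J.PosDef) (hkR : 0 < p.kR) (hkI : 0 < p.kI) (hc2 : 0 < p.c2)
    (hgain : p.c2 < √(p.kR * minEig p.J) / maxEig p.J) :
    ∃ μ > 0, ∀ (n w η : E3) (Ψ : ℝ), ‖n‖ ^ 2 = Ψ * (2 - Ψ) →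
      μ * (‖n‖ ^ 2 + ‖w‖ ^ 2 + ‖η‖ ^ 2) ≤ attLyap p n w η Ψ := by
  have hL := maxEig_pos hJ
  have hl := minEig_pos hJ
  rw [lt_div_iff₀ hL] at hgain
  have h1 := (Real.lt_sqrt (by positivity)).1 hgain
  obtain ⟨lam, hlam, hq⟩ := exists_pos_quadratic (a := p.kR / 2) (b := p.c2 * maxEig p.J / 2)
    (c := minEig p.J / 2) (by positivity) (by positivity) (by nlinarith)
  refine ⟨min lam (p.kI / 2), lt_min hlam (by positivity), fun n w η Ψ hΨ => ?_⟩
  have h2 := minEig_mul_norm_sq_le hJ.isHermitian w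
  have h3 : -(maxEig p.J * (‖n‖ * ‖w‖)) ≤ inner ℝ n (act p.J w) := by
    have := neg_mul_norm_le_inner n (act p.J w)
    have := mul_le_mul_of_nonneg_left (norm_act_le_maxEig hJ w) (norm_nonneg n)
    linarith
  have h4 := mul_le_mul_of_nonneg_left h3 hc2.le
  have h5 := hq ‖n‖ ‖w‖
  have h6 : p.kR / 2 * ‖n‖ ^ 2 ≤ p.kR * Ψ := by rw [hΨ]; nlinarith [mul_nonneg hkR.le (sq_nonneg Ψ)]
  have h7 : min lam (p.kI / 2) * (‖n‖ ^ 2 + ‖w‖ ^ 2) ≤ lam * (‖n‖ ^ 2 + ‖w‖ ^ 2) := by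
    gcongr; exact min_le_left _ _
  have h8 : min lam (p.kI / 2) * ‖η‖ ^ 2 ≤ p.kI / 2 * ‖η‖ ^ 2 := by
    gcongr; exact min_le_right _ _
  unfold attLyap
  linarith

/-- Here Ψ < 1 matters: it gives Ψ ≤ Ψ(2 - Ψ) = ‖n‖². -/
theorem exists_attLyap_le (hJ : p.J.PosDef) (hkR : 0 < p.kR) (hkI : 0 < p.kI) (hc2 : 0 < p.c2) :
    ∃ M > 0, ∀ (n w η : E3) (Ψ : ℝ), ‖n‖ ^ 2 = Ψ * (2 - Ψ) → Ψ < 1 →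
      attLyap p n w η Ψ ≤ M * (‖n‖ ^ 2 + ‖w‖ ^ 2 + ‖η‖ ^ 2) := by
  have hL := maxEig_pos hJ
  set L := maxEig p.J with hLdef
  refine ⟨L + p.kR + p.c2 * L + p.kI, by positivity, fun n w η Ψ hΨ hΨ1 => ?_⟩
  have hJw := norm_act_le_maxEig hJ w
  rw [← hLdef] at hJw
  have h4 : inner ℝ w (act p.J w) ≤ L * ‖w‖ ^ 2 := by
    refine (real_inner_le_norm _ _).trans ?_
    calc ‖w‖ * ‖act p.J w‖ ≤ ‖w‖ * (L * ‖w‖) := by gcongr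
      _ = _ := by ring
  have h5 : inner ℝ n (act p.J w) ≤ L * (‖n‖ ^ 2 + ‖w‖ ^ 2) := by
    refine (real_inner_le_norm _ _).trans ?_
    calc ‖n‖ * ‖act p.J w‖ ≤ ‖n‖ * (L * ‖w‖) := by gcongr
      _ = L * (‖n‖ * ‖w‖) := by ring
      _ ≤ _ := by
        gcongr
        nlinarith [sq_nonneg (‖n‖ - ‖w‖), sq_nonneg ‖n‖, sq_nonneg ‖w‖]
  have h6 := mul_le_mul_of_nonneg_left h5 hc2.le
  have hΨ0 : 0 ≤ Ψ := nonneg_of_mul_nonneg_left (hΨ ▸ sq_nonneg ‖n‖) (by linarith)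
  have h7 : p.kR * Ψ ≤ p.kR * ‖n‖ ^ 2 := by
    gcongr
    rw [hΨ]
    nlinarith
  have z1 : 0 ≤ L * (2 * ‖n‖ ^ 2 + ‖w‖ ^ 2 + 2 * ‖η‖ ^ 2) := by positivity
  have z2 : 0 ≤ p.kR * (‖w‖ ^ 2 + ‖η‖ ^ 2) := by positivity
  have z3 : 0 ≤ p.c2 * L * ‖η‖ ^ 2 := by positivity
  have z4 : 0 ≤ p.kI * (2 * ‖n‖ ^ 2 + 2 * ‖w‖ ^ 2 + ‖η‖ ^ 2) := by positivity
  unfold attLyap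
  linarith

end Attitude

/-! ### Exponential decay of the error dynamics -/

theorem abs_cross_terms_le {p : Params} (hm : 0 < p.m) (hJ : p.J.PosDef) (v w e η : E3) :
    |p.m * inner ℝ e v + inner ℝ η (act p.J w)|
      ≤ (p.m + maxEig p.J) * (‖v‖ ^ 2 + ‖w‖ ^ 2 + (‖e‖ ^ 2 + ‖η‖ ^ 2)) := by
  have hL := maxEig_pos hJ
  have h1 : |p.m * inner ℝ e v| ≤ p.m * (‖v‖ ^ 2 + ‖w‖ ^ 2 + (‖e‖ ^ 2 + ‖η‖ ^ 2)) := by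
    rw [abs_mul, abs_of_pos hm]
    gcongr
    refine (abs_real_inner_le_norm e v).trans ?_
    nlinarith [sq_nonneg (‖e‖ - ‖v‖), sq_nonneg ‖e‖, sq_nonneg ‖v‖, sq_nonneg ‖w‖, sq_nonneg ‖η‖]
  have h2 : |inner ℝ η (act p.J w)|
      ≤ maxEig p.J * (‖v‖ ^ 2 + ‖w‖ ^ 2 + (‖e‖ ^ 2 + ‖η‖ ^ 2)) := by
    refine (abs_real_inner_le_norm _ _).trans ?_
    calc ‖η‖ * ‖act p.J w‖ ≤ ‖η‖ * (maxEig p.J * ‖w‖) := by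
          gcongr; exact norm_act_le_maxEig hJ w
      _ = maxEig p.J * (‖η‖ * ‖w‖) := by ring
      _ ≤ _ := by
        gcongr
        nlinarith [sq_nonneg (‖η‖ - ‖w‖), sq_nonneg ‖e‖, sq_nonneg ‖v‖, sq_nonneg ‖w‖,
          sq_nonneg ‖η‖]
  rw [add_mul]
  exact (abs_add_le _ _).trans (add_le_add h1 h2)

set_option maxHeartbeats 1600000 in
-- Two passes over the same function U: its monotonicity first confines the integral errors in terms
-- of `r`, and on that set U is comparable with q + i and the cross term D is dissipative.
theorem ErrorDynamics.exists_exp_decay {p : Params} {Δx ΔR : E3} {δx F B ψ exmax α : ℝ}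
    (hm : 0 < p.m) (hJ : p.J.PosDef) (hΔx : ∀ i, |Δx i| ≤ δx)
    (hkx : 0 < p.kx) (hkv : 0 < p.kv) (hki : 0 < p.ki) (hkR : 0 < p.kR) (hkΩ : 0 < p.kΩ)
    (hkI : 0 < p.kI) (hc1 : 0 < p.c1) (hc2 : 0 < p.c2) (hσ : 0 < p.σ)
    (hψ0 : 0 < ψ) (hψ1 : ψ < 1) (hα : α = √(ψ * (2 - ψ))) (hkiσ : δx < p.ki * p.σ)
    (hc1b : p.c1 < min (4 * p.kx * p.kv * (1 - α) ^ 2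
      / (p.kv ^ 2 * (1 + α) ^ 2 + 4 * p.m * p.kx * (1 - α))) √(p.kx / p.m))
    (hc2b : p.c2 < min (√(p.kR * minEig p.J) / maxEig p.J)
      (4 * p.kR * p.kΩ / (8 * p.kR * maxEig p.J + (p.kΩ + B) ^ 2)))
    {r : ℝ} (hr : 0 < r) :
    ∃ C > 0, ∃ γ > 0, ∀ (t₀ T τ : ℝ) (ex ev ei eR eΩ eI : ℝ → E3) (Ψ : ℝ → ℝ) (q i : ℝ → ℝ),
      ErrorDynamics p F B Δx ΔR (Set.Ico t₀ T) ex ev ei eR eΩ eI Ψ →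
      (∀ t, q t = ‖ex t‖ ^ 2 + ‖ev t‖ ^ 2 + ‖eR t‖ ^ 2 + ‖eΩ t‖ ^ 2) →
      (∀ t, i t = ‖ei t - p.ki⁻¹ • Δx‖ ^ 2 + ‖eI t - p.kI⁻¹ • ΔR‖ ^ 2) →
      τ ∈ Set.Ico t₀ T → (∀ t ∈ Set.Icc t₀ τ, Ψ t < ψ ∧ ‖ex t‖ < exmax) →
      q t₀ + i t₀ ≤ r ^ 2 →
      q τ + i τ ≤ C * (q t₀ + i t₀) * Real.exp (-γ * (τ - t₀)) := by
  have hJt : p.Jᵀ = p.J := by simpa [Matrix.IsHermitian] using hJ.isHermitian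
  have hα0 : 0 ≤ α := hα ▸ Real.sqrt_nonneg _
  have hα2 : α ^ 2 = ψ * (2 - ψ) := by rw [hα, Real.sq_sqrt (by nlinarith)]
  have hα1 : α < 1 := by nlinarith
  obtain ⟨hc1a, hc1b⟩ := lt_min_iff.1 hc1b
  obtain ⟨hc2a, hc2b⟩ := lt_min_iff.1 hc2b
  obtain ⟨lam1, hlam1, K1, hK1, hdiss1⟩ :=
    exists_posRate_le (F := F) (exmax := exmax) hm hkx hkv hc1 hα0 hα1 hc1a
  obtain ⟨μ1, hμ1, hlow1⟩ := exists_le_posLyap hm hkx hc1 hc1b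
  obtain ⟨M1, hM1, hup1⟩ := exists_posLyap_le hm hkx hki hc1
  obtain ⟨lam2, hlam2, hdiss2⟩ := exists_attRate_le hJ hkR hkΩ hc2 hc2b
  obtain ⟨μ2, hμ2, hlow2⟩ := exists_le_attLyap hJ hkR hkI hc2 hc2a
  obtain ⟨M2, hM2, hup2⟩ := exists_attLyap_le hJ hkR hkI hc2
  -- This weight makes the attitude dissipation cover the cost K1‖e_R‖² left by the position
  -- estimate and still retain the rate `lam1`.
  set L := (K1 + lam1) / lam2 with hLdef
  have hL : 0 < L := by positivity
  have hLlam : L * lam2 = K1 + lam1 := div_mul_cancel₀ _ hlam2.ne'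
  clear_value L
  have hM : 0 < M1 + L * M2 := by positivity
  set E := (M1 + L * M2) * r ^ 2 with hE
  have hE0 : 0 ≤ E := by positivity
  set c := p.ki⁻¹ • Δx with hc
  have hcs : ∀ y : E3, p.ki • y - Δx = p.ki • (y - c) := fun y => by
    rw [smul_sub, hc, smul_inv_smul₀ hki.ne']
  have hIs : ∀ y : E3, p.kI • y - ΔR = p.kI • (y - p.kI⁻¹ • ΔR) := fun y => by
    rw [smul_sub, smul_inv_smul₀ hkI.ne']
  -- The margin left to the saturation at the equilibrium Δ_x/k_i; it is positive because k_i σ >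
  -- δ_x.
  set d := p.σ - δx / p.ki with hd
  have hd0 : 0 < d := by
    rw [hd, sub_pos, div_lt_iff₀ hki]; linarith
  have hdc : ∀ i, d ≤ p.σ - |c i| := fun i => by
    have : |c i| ≤ δx / p.ki := by
      rw [hc, PiLp.smul_apply, smul_eq_mul, abs_mul, abs_inv, abs_of_pos hki, div_eq_inv_mul]
      exact mul_le_mul_of_nonneg_left (hΔx i) (by positivity)
    linarith
  -- The sublevel set U ≤ E gives a saturation potential of at most E/k_i, hence this coordinate
  -- bound; `rI` below is the analogous radius for the attitude integral.
  set ρ := d + 2 * (E / p.ki) / d with hρ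
  have hρd : d ≤ ρ := by
    have : 0 ≤ 2 * (E / p.ki) / d := by positivity
    linarith
  have hρ0 : 0 < ρ := hd0.trans_le hρd
  set a₀ := d / ρ with ha₀
  have ha₀0 : 0 < a₀ := by positivity
  set rI := √(E / (L * μ2)) with hrI
  obtain ⟨K3, hK3, hcross1⟩ := exists_posCross_le (F := F) hm hkx hkv hki hc1 ha₀0
  -- The sign of `B` is not known before a motion is given, hence `max B 0`.
  obtain ⟨K4, hK4, hcross2⟩ := exists_attCross_le (B := max B 0) (r := rI) hJ hkR hkΩ hkI hc2
    (le_max_right _ _) (Real.sqrt_nonneg _)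
  set κ := min (p.ki * a₀ / 2) (p.kI / 2) with hκ
  have hκ0 : 0 < κ := lt_min (by positivity) (by positivity)
  set μ := min μ1 (min (p.ki * (a₀ / 2)) (L * μ2)) with hμ
  have hμ0 : 0 < μ := lt_min hμ1 (lt_min (by positivity) (by positivity))
  have hN : 0 < p.m + maxEig p.J := add_pos hm (maxEig_pos hJ)
  obtain ⟨C, hC, γ, hγ, hdecay⟩ := exp_decay_of_cross_term hlam1 hκ0 (add_pos hK3 hK4) hN hμ0 hM
  refine ⟨C, hC, γ, hγ, ?_⟩
  intro t₀ T τ ex ev ei eR eΩ eI Ψ q i hdyn hq hi hτ hdom hini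
  set η : ℝ → E3 := fun t => eI t - p.kI⁻¹ • ΔR with hη
  have hmem : ∀ t ∈ Set.Icc t₀ τ, t ∈ Set.Ico t₀ T := fun t ht => ⟨ht.1, ht.2.trans_lt hτ.2⟩
  have hΨ1 : ∀ t ∈ Set.Icc t₀ τ, Ψ t < 1 := fun t ht => (hdom t ht).1.trans hψ1
  have hnα : ∀ t ∈ Set.Icc t₀ τ, ‖eR t‖ ≤ α := fun t ht => by
    refine abs_le_of_sq_le_sq' ?_ hα0 |>.2
    rw [hdyn.eR_sq t (hmem t ht), hα2]
    nlinarith [(hdom t ht).1, hΨ1 t ht]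
  set U : ℝ → ℝ := fun t => posLyap p c (ex t) (ev t) (ei t)
    + L * attLyap p (eR t) (eΩ t) (η t) (Ψ t) with hU
  set D : ℝ → ℝ := fun t => p.m * inner ℝ (ei t - c) (ev t) + inner ℝ (η t) (act p.J (eΩ t))
    with hD
  have hηd : ∀ t ∈ Set.Icc t₀ τ, HasDerivWithinAt η (eΩ t + p.c2 • eR t) (Set.Ico t₀ T) t :=
    fun t ht => (hdyn.eI_deriv t (hmem t ht)).sub_const _
  have hUd : ∀ t ∈ Set.Icc t₀ τ,
      ∃ U', HasDerivWithinAt U U' (Set.Ico t₀ T) t ∧ U' ≤ -lam1 * q t := by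
    intro t ht
    obtain ⟨a, X, ha, hma, hX⟩ := hdyn.ev_deriv t (hmem t ht)
    obtain ⟨n', hn', hn'le⟩ := hdyn.eR_deriv t (hmem t ht)
    obtain ⟨w, dd, hw, hdd, hJw⟩ := hdyn.eΩ_deriv t (hmem t ht)
    rw [hcs] at hma
    rw [hIs] at hJw
    refine ⟨_, (hasDerivWithinAt_posLyap hσ c (hdyn.ex_deriv t (hmem t ht)) ha
      (hdyn.ei_deriv t (hmem t ht))).add ((hasDerivWithinAt_attLyap hJt hn' hw (hηd t ht)
      (hdyn.Ψ_deriv t (hmem t ht))).const_mul L), ?_⟩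
    have h1 := hdiss1 c (ex t) (ev t) (ei t) a X (eR t) hma (hX (hΨ1 t ht)) (hnα t ht)
      (hdom t ht).2.le
    have h2 := hdiss2 (eR t) (eΩ t) (η t) n' dd _ hJw (hn'le (hΨ1 t ht)) hdd
      ((hnα t ht).trans hα1.le)
    have h3 := mul_le_mul_of_nonneg_left h2 hL.le
    have h4 : L * (-lam2 * (‖eR t‖ ^ 2 + ‖eΩ t‖ ^ 2))
        = -(K1 + lam1) * (‖eR t‖ ^ 2 + ‖eΩ t‖ ^ 2) := by rw [← hLlam]; ring
    have h5 : 0 ≤ K1 * ‖eΩ t‖ ^ 2 := by positivity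
    rw [hq]
    linarith
  have hUup : ∀ t ∈ Set.Icc t₀ τ, U t ≤ (M1 + L * M2) * (q t + i t) := by
    intro t ht
    have h1 := hup1 c (ex t) (ev t) (ei t)
    have h2 := mul_le_mul_of_nonneg_left (hup2 (eR t) (eΩ t) (η t) (Ψ t)
      (hdyn.eR_sq t (hmem t ht)) (hΨ1 t ht)) hL.le
    have z1 : 0 ≤ M1 * (‖eR t‖ ^ 2 + ‖eΩ t‖ ^ 2 + ‖η t‖ ^ 2) := by positivity
    have z2 : 0 ≤ L * M2 * (‖ex t‖ ^ 2 + ‖ev t‖ ^ 2 + ‖ei t - c‖ ^ 2) := by positivity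
    rw [hq, hi]
    simp only [hη] at h2 z1 ⊢
    linarith
  have hUlow : ∀ t ∈ Set.Icc t₀ τ, μ1 * (‖ex t‖ ^ 2 + ‖ev t‖ ^ 2)
      + p.ki * satPotVec p.σ c (ei t)
      + L * μ2 * (‖eR t‖ ^ 2 + ‖eΩ t‖ ^ 2 + ‖η t‖ ^ 2) ≤ U t := by
    intro t ht
    have h1 := hlow1 c (ex t) (ev t) (ei t)
    have h2 := mul_le_mul_of_nonneg_left (hlow2 (eR t) (eΩ t) (η t) (Ψ t)
      (hdyn.eR_sq t (hmem t ht))) hL.le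
    simp only [hU]
    linarith
  have hUE : ∀ t ∈ Set.Icc t₀ τ, U t ≤ E := by
    intro t ht
    have h0 := hUup t₀ (Set.left_mem_Icc.2 hτ.1)
    refine (le_of_derivWithin_nonpos (hmem t ht) fun s hs => ?_).trans
      (h0.trans (mul_le_mul_of_nonneg_left hini hM.le))
    obtain ⟨U', h1, h2⟩ := hUd s ⟨hs.1, hs.2.trans ht.2⟩
    refine ⟨U', h1, h2.trans ?_⟩
    have : 0 ≤ q s := by rw [hq]; positivity
    nlinarith
  have hcoord : ∀ t ∈ Set.Icc t₀ τ, ∀ j, |ei t j - c j| ≤ ρ := by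
    intro t ht
    refine abs_sub_le_of_satPotVec_le hdc hd0 ?_
    rw [le_div_iff₀ hki]
    have h1 := hUlow t ht
    have h2 := hUE t ht
    have z1 : 0 ≤ μ1 * (‖ex t‖ ^ 2 + ‖ev t‖ ^ 2) := by positivity
    have z2 : 0 ≤ L * μ2 * (‖eR t‖ ^ 2 + ‖eΩ t‖ ^ 2 + ‖η t‖ ^ 2) := by positivity
    linarith
  have hηr : ∀ t ∈ Set.Icc t₀ τ, ‖η t‖ ≤ rI := by
    intro t ht
    refine Real.le_sqrt_of_sq_le ?_
    rw [le_div_iff₀ (by positivity)]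
    have h1 := hUlow t ht
    have h2 := hUE t ht
    have z1 : 0 ≤ μ1 * (‖ex t‖ ^ 2 + ‖ev t‖ ^ 2) := by positivity
    have z2 : 0 ≤ L * μ2 * (‖eR t‖ ^ 2 + ‖eΩ t‖ ^ 2) := by positivity
    have z3 := mul_nonneg hki.le (satPotVec_nonneg hdc hd0 (ei t))
    linarith
  refine hdecay t₀ T τ U D q i hτ fun t ht => ⟨by rw [hq]; positivity, by rw [hi]; positivity,
    ?_, hUup t ht, ?_, hUd t ht, ?_⟩
  · have h1 := hUlow t ht
    have h2 := mul_le_mul_of_nonneg_left (satPotVec_ge hdc hd0 hρd (hcoord t ht)) hki.le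
    rw [← ha₀] at h2
    have h3 : μ * (‖ex t‖ ^ 2 + ‖ev t‖ ^ 2) ≤ μ1 * (‖ex t‖ ^ 2 + ‖ev t‖ ^ 2) :=
      mul_le_mul_of_nonneg_right (min_le_left _ _) (by positivity)
    have h4 : μ * ‖ei t - c‖ ^ 2 ≤ p.ki * (a₀ / 2) * ‖ei t - c‖ ^ 2 :=
      mul_le_mul_of_nonneg_right ((min_le_right _ _).trans (min_le_left _ _)) (by positivity)
    have h5 : μ * (‖eR t‖ ^ 2 + ‖eΩ t‖ ^ 2 + ‖η t‖ ^ 2)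
        ≤ L * μ2 * (‖eR t‖ ^ 2 + ‖eΩ t‖ ^ 2 + ‖η t‖ ^ 2) :=
      mul_le_mul_of_nonneg_right ((min_le_right _ _).trans (min_le_right _ _)) (by positivity)
    rw [hq, hi]
    simp only [hη] at h1 h5 ⊢
    linarith
  · refine (abs_cross_terms_le hm hJ (ev t) (eΩ t) (ei t - c) (η t)).trans ?_
    refine mul_le_mul_of_nonneg_left ?_ hN.le
    rw [hq, hi]
    simp only [hη]
    linarith [sq_nonneg ‖ex t‖, sq_nonneg ‖eR t‖]
  · obtain ⟨a, X, ha, hma, hX⟩ := hdyn.ev_deriv t (hmem t ht)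
    obtain ⟨w, dd, hw, hdd, hJw⟩ := hdyn.eΩ_deriv t (hmem t ht)
    rw [hcs] at hma
    rw [hIs] at hJw
    refine ⟨_, ((((hdyn.ei_deriv t (hmem t ht)).sub_const c).inner ℝ ha).const_mul p.m).add
      ((hηd t ht).inner ℝ (hasDerivWithinAt_act p.J hw)), ?_⟩
    have h1 := hcross1 c (ex t) (ev t) (ei t) a X (eR t) hma (hX (hΨ1 t ht))
      ((hnα t ht).trans hα1.le) (inner_satVec_sub_ge hdc hd0 hρd (hcoord t ht))
    have h2 := hcross2 (eR t) (eΩ t) (η t) dd _ hJw (hdd.trans (le_max_left _ _)) (hηr t ht)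
    have h3 : κ * ‖ei t - c‖ ^ 2 ≤ p.ki * a₀ / 2 * ‖ei t - c‖ ^ 2 :=
      mul_le_mul_of_nonneg_right (min_le_left _ _) (by positivity)
    have h4 : κ * ‖η t‖ ^ 2 ≤ p.kI / 2 * ‖η t‖ ^ 2 :=
      mul_le_mul_of_nonneg_right (min_le_right _ _) (by positivity)
    have z1 : 0 ≤ K3 * ‖eΩ t‖ ^ 2 := by positivity
    have z2 : 0 ≤ K4 * (‖ex t‖ ^ 2 + ‖ev t‖ ^ 2) := by positivity
    rw [hq, hi]
    simp only [hη] at h2 h4 ⊢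
    linarith

/-! ### Invariance of the domain -/

/-- If `f < a` and `g < b` on initial segments force the stronger bounds `f ≤ a'` and `g ≤ b'`, then
`f < a` and `g < b` hold throughout. -/
theorem lt_of_bootstrap {f g : ℝ → ℝ} {a a' b b' t₀ τ : ℝ}
    (hf : ContinuousOn f (Set.Icc t₀ τ)) (hg : ContinuousOn g (Set.Icc t₀ τ)) (ha : a' < a)
    (hb : b' < b) (h0 : f t₀ < a ∧ g t₀ < b)
    (h : ∀ t ∈ Set.Icc t₀ τ, (∀ u ∈ Set.Icc t₀ t, f u < a ∧ g u < b) → f t ≤ a' ∧ g t ≤ b') :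
    ∀ t ∈ Set.Icc t₀ τ, f t < a ∧ g t < b := by
  by_contra! hcon
  obtain ⟨t₁, ht₁, hbad⟩ := hcon
  -- The compact set of times violating a bound has a least element `e`. The stronger bounds hold
  -- before `e` and pass to `e` by continuity, a contradiction.
  set S : Set ℝ := (Set.Icc t₀ τ ∩ f ⁻¹' Set.Ici a) ∪ (Set.Icc t₀ τ ∩ g ⁻¹' Set.Ici b) with hS
  have hSc : IsClosed S :=
    (hf.preimage_isClosed_of_isClosed isClosed_Icc isClosed_Ici).union
      (hg.preimage_isClosed_of_isClosed isClosed_Icc isClosed_Ici)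
  have hSsub : S ⊆ Set.Icc t₀ τ :=
    Set.union_subset Set.inter_subset_left Set.inter_subset_left
  have hSne : S.Nonempty := by
    refine ⟨t₁, ?_⟩
    by_cases hft : f t₁ < a
    · exact Or.inr ⟨ht₁, hbad hft⟩
    · exact Or.inl ⟨ht₁, not_lt.1 hft⟩
  obtain ⟨e, heS, hleast⟩ := (isCompact_Icc.of_isClosed_subset hSc hSsub).exists_isLeast hSne
  have heI := hSsub heS
  have hgood : ∀ u ∈ Set.Ico t₀ e, f u < a ∧ g u < b := by
    intro u hu
    have huI : u ∈ Set.Icc t₀ τ := ⟨hu.1, hu.2.le.trans heI.2⟩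
    constructor
    · by_contra hn
      exact absurd (hleast (Or.inl ⟨huI, not_lt.1 hn⟩)) (not_le.2 hu.2)
    · by_contra hn
      exact absurd (hleast (Or.inr ⟨huI, not_lt.1 hn⟩)) (not_le.2 hu.2)
  have hne : t₀ < e := by
    refine lt_of_le_of_ne heI.1 fun heq => ?_
    subst heq
    rcases heS with h1 | h1
    · exact absurd h1.2 (not_le.2 h0.1)
    · exact absurd h1.2 (not_le.2 h0.2)
  have hsub : Set.Icc t₀ e ⊆ Set.Icc t₀ τ := Set.Icc_subset_Icc_right heI.2
  have hstrong : ∀ u ∈ Set.Ico t₀ e, f u ≤ a' ∧ g u ≤ b' := fun u hu =>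
    h u ⟨hu.1, hu.2.le.trans heI.2⟩ fun w hw => hgood w ⟨hw.1, hw.2.trans_lt hu.2⟩
  have hcl : closure (Set.Ico t₀ e) = Set.Icc t₀ e := closure_Ico hne.ne
  have hfs : Set.Ico t₀ e ⊆ Set.Icc t₀ e ∩ f ⁻¹' Set.Iic a' :=
    fun u hu => ⟨Set.Ico_subset_Icc_self hu, (hstrong u hu).1⟩
  have hfe : e ∈ Set.Icc t₀ e ∩ f ⁻¹' Set.Iic a' :=
    closure_minimal hfs
      ((hf.mono hsub).preimage_isClosed_of_isClosed isClosed_Icc isClosed_Iic)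
      (hcl ▸ Set.right_mem_Icc.2 hne.le)
  have hgs : Set.Ico t₀ e ⊆ Set.Icc t₀ e ∩ g ⁻¹' Set.Iic b' :=
    fun u hu => ⟨Set.Ico_subset_Icc_self hu, (hstrong u hu).2⟩
  have hge : e ∈ Set.Icc t₀ e ∩ g ⁻¹' Set.Iic b' :=
    closure_minimal hgs
      ((hg.mono hsub).preimage_isClosed_of_isClosed isClosed_Icc isClosed_Iic)
      (hcl ▸ Set.right_mem_Icc.2 hne.le)
  rcases heS with h1 | h1
  · exact absurd h1.2 (not_le.2 (lt_of_le_of_lt hfe.2 ha))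
  · exact absurd h1.2 (not_le.2 (lt_of_le_of_lt hge.2 hb))

/-- Square roots of an exponential estimate for the squared errors. -/
theorem sqrt_le_of_exp_decay {q i q₀ C γ s : ℝ} (hi : 0 ≤ i) (hC : 0 ≤ C)
    (h : q + i ≤ C * q₀ * Real.exp (-γ * s)) :
    √q ≤ √C * √q₀ * Real.exp (-(γ / 2) * s) := by
  have h1 : Real.exp (-γ * s) = Real.exp (-(γ / 2) * s) ^ 2 := by
    rw [← Real.exp_nat_mul]; congr 1; push_cast; ring
  calc √q ≤ √(C * q₀ * Real.exp (-(γ / 2) * s) ^ 2) := Real.sqrt_le_sqrt (by rw [← h1]; linarith)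
    _ = _ := by
      rw [mul_assoc, Real.sqrt_mul hC, Real.sqrt_mul' _ (sq_nonneg _),
        Real.sqrt_sq (Real.exp_pos _).le, mul_assoc]

/-- While the motion stays in the domain, the tracking errors decay exponentially and the integral
terms are bounded, uniformly over the motions with initial errors at most `r`. -/
theorem Motion.exists_trackErr_le
    (p : Params) (xd : ℝ → E3) (Δx ΔR : E3)
    (δx B1 B2 ψ1 exmax α : ℝ)
    (hm : 0 < p.m) (hJ : p.J.PosDef) (hxd : ContDiff ℝ ∞ xd)
    (hB1 : ∀ t : ℝ, 0 ≤ t → ‖-((p.m * p.g) • e3) + p.m • deriv (deriv xd) t‖ < B1)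
    (hΔx : ∀ i, |Δx i| ≤ δx)
    (hkx : 0 < p.kx) (hkv : 0 < p.kv) (hki : 0 < p.ki) (hkR : 0 < p.kR) (hkΩ : 0 < p.kΩ)
    (hkI : 0 < p.kI) (hc1 : 0 < p.c1) (hc2 : 0 < p.c2) (hσ : 0 < p.σ)
    (hψ1 : 0 < ψ1) (hψ1' : ψ1 < 1) (hα : α = √(ψ1 * (2 - ψ1))) (hkiσ : δx < p.ki * p.σ)
    (hc1b : p.c1 < min
      (4 * p.kx * p.kv * (1 - α) ^ 2 / (p.kv ^ 2 * (1 + α) ^ 2 + 4 * p.m * p.kx * (1 - α)))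
      √(p.kx / p.m))
    (hc2b : p.c2 < min (√(p.kR * minEig p.J) / maxEig p.J)
      (4 * p.kR * p.kΩ / (8 * p.kR * maxEig p.J + (p.kΩ + B2) ^ 2)))
    {r : ℝ} (hr : 0 < r) :
    ∃ C > 0, ∃ β > 0, ∀ (t₀ T : ℝ) (s : Motion), 0 ≤ t₀ →
      s.IsClosedLoop p xd (Set.Ico t₀ T) Δx ΔR →
      (∀ t ∈ Set.Ico t₀ T, specNorm ((2 : ℝ) • p.J - p.J.trace • (1 : M3))
        * ‖s.Ωc p xd (Set.Ico t₀ T) t‖ ≤ B2) →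
      s.fullErr p xd (Set.Ico t₀ T) t₀ Δx ΔR ≤ r →
      ∀ τ ∈ Set.Ico t₀ T, (∀ t ∈ Set.Icc t₀ τ, s.Ψ p xd t < ψ1 ∧ ‖s.ex xd t‖ < exmax) →
        s.trackErr p xd (Set.Ico t₀ T) τ
          ≤ C * s.fullErr p xd (Set.Ico t₀ T) t₀ Δx ΔR * Real.exp (-β * (τ - t₀)) ∧
        ‖s.ei τ‖ ≤ C ∧ ‖s.eI τ‖ ≤ C := by
  have hJt : p.Jᵀ = p.J := by simpa [Matrix.IsHermitian] using hJ.isHermitian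
  obtain ⟨C, hC, γ, hγ, hdecay⟩ := ErrorDynamics.exists_exp_decay (F := √3 * p.ki * p.σ + B1)
    (B := B2) (ΔR := ΔR) (exmax := exmax) hm hJ hΔx hkx hkv hki hkR hkΩ hkI hc1 hc2 hσ hψ1 hψ1' hα
    hkiσ hc1b hc2b hr
  have hsC : 0 < √C := Real.sqrt_pos.2 hC
  refine ⟨√C + √C * r + ‖p.ki⁻¹ • Δx‖ + ‖p.kI⁻¹ • ΔR‖, by positivity, γ / 2, by positivity, ?_⟩
  intro t₀ T s ht₀ hcl hB2 hini τ hτ hdom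
  have hdyn := hcl.errorDynamics ht₀ hxd hJt hB1 hB2 hkx.le hkv.le hki.le hσ
  set I := Set.Ico t₀ T
  set q : ℝ → ℝ := fun t => ‖s.ex xd t‖ ^ 2 + ‖s.ev xd t‖ ^ 2 + ‖s.eR p xd t‖ ^ 2
    + ‖s.eΩ p xd I t‖ ^ 2 with hq
  set i : ℝ → ℝ := fun t => ‖s.ei t - p.ki⁻¹ • Δx‖ ^ 2 + ‖s.eI t - p.kI⁻¹ • ΔR‖ ^ 2 with hi
  have hfull : s.fullErr p xd I t₀ Δx ΔR = √(q t₀ + i t₀) := by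
    simp only [hq, hi, Motion.fullErr]
    congr 1
    ring
  have hqi : q t₀ + i t₀ ≤ r ^ 2 := by
    rw [hfull] at hini
    exact (Real.sqrt_le_left hr.le).1 hini
  have hq0 : 0 ≤ q τ := by simp only [hq]; positivity
  have hi0 : 0 ≤ i τ := by simp only [hi]; positivity
  have hd := hdecay t₀ T τ _ _ _ _ _ _ _ q i hdyn (fun _ => rfl) (fun _ => rfl) hτ hdom hqi
  have htr := sqrt_le_of_exp_decay hi0 hC.le hd
  have hf0 : 0 ≤ s.fullErr p xd I t₀ Δx ΔR := Real.sqrt_nonneg _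
  have hexp : Real.exp (-(γ / 2) * (τ - t₀)) ≤ 1 := by
    rw [Real.exp_le_one_iff]
    nlinarith [hτ.1]
  have hsi : √(i τ) ≤ √C * r := by
    -- With q and i exchanged, the same square-root estimate controls the integral errors.
    rw [add_comm] at hd
    have h1 := sqrt_le_of_exp_decay hq0 hC.le hd
    rw [← hfull] at h1
    calc √(i τ) ≤ √C * s.fullErr p xd I t₀ Δx ΔR * Real.exp (-(γ / 2) * (τ - t₀)) := h1
      _ ≤ √C * s.fullErr p xd I t₀ Δx ΔR * 1 := by gcongr
      _ ≤ √C * r := by rw [mul_one]; gcongr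
  rw [← hfull] at htr
  refine ⟨?_, ?_, ?_⟩
  · refine htr.trans ?_
    gcongr
    have : 0 ≤ √C * r := by positivity
    linarith [norm_nonneg (p.ki⁻¹ • Δx), norm_nonneg (p.kI⁻¹ • ΔR)]
  · have h1 : ‖s.ei τ - p.ki⁻¹ • Δx‖ ≤ √(i τ) :=
      Real.le_sqrt_of_sq_le (by simp only [hi]; linarith [sq_nonneg ‖s.eI τ - p.kI⁻¹ • ΔR‖])
    have h2 := norm_le_norm_sub_add (s.ei τ) (p.ki⁻¹ • Δx)
    linarith [norm_nonneg (p.kI⁻¹ • ΔR)]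
  · have h1 : ‖s.eI τ - p.kI⁻¹ • ΔR‖ ≤ √(i τ) :=
      Real.le_sqrt_of_sq_le (by simp only [hi]; linarith [sq_nonneg ‖s.ei τ - p.ki⁻¹ • Δx‖])
    have h2 := norm_le_norm_sub_add (s.eI τ) (p.kI⁻¹ • ΔR)
    linarith [norm_nonneg (p.ki⁻¹ • Δx)]

end Quadrotor

/-! ### The stability theorem -/

theorem proposition3
    (p : Quadrotor.Params) (xd : ℝ → Quadrotor.E3) (Δx ΔR : Quadrotor.E3)
    (δx B1 B2 ψ1 exmax α : ℝ)
    -- the vehicle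
    (hm : 0 < p.m) (hJ : p.J.PosDef)
    -- the smooth position command and its bound, the bound of the disturbance
    (hxd : ContDiff ℝ ∞ xd)
    (hB1 : ∀ t : ℝ, 0 ≤ t →
      ‖-((p.m * p.g) • Quadrotor.e3) + p.m • deriv (deriv xd) t‖ < B1)
    (hΔx : ∀ i, |Δx i| ≤ δx)
    -- positivity of the parameters
    (hkx : 0 < p.kx) (hkv : 0 < p.kv) (hki : 0 < p.ki) (hkR : 0 < p.kR) (hkΩ : 0 < p.kΩ)
    (hkI : 0 < p.kI) (hc1 : 0 < p.c1) (hc2 : 0 < p.c2) (hσ : 0 < p.σ)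
    (hψ1 : 0 < ψ1) (hψ1' : ψ1 < 1) (hexmax : 0 < exmax)
    (hα : α = √(ψ1 * (2 - ψ1)))
    -- the conditions on the gains
    (hkiσ : δx < p.ki * p.σ)
    (hc1b : p.c1 < min
      (4 * p.kx * p.kv * (1 - α) ^ 2 / (p.kv ^ 2 * (1 + α) ^ 2 + 4 * p.m * p.kx * (1 - α)))
      √(p.kx / p.m))
    (hkRkWb : Quadrotor.specNorm (Quadrotor.W12 p B1 exmax) ^ 2
      / (4 * Quadrotor.minEig (Quadrotor.W1 p α)) < Quadrotor.minEig (Quadrotor.W2 p B2))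
    (hc2b : p.c2 < min
      (√(p.kR * Quadrotor.minEig p.J) / Quadrotor.maxEig p.J)
      (4 * p.kR * p.kΩ / (8 * p.kR * Quadrotor.maxEig p.J + (p.kΩ + B2) ^ 2))) :
    -- exponential stability, uniformly in the initial time
    (∃ δ > 0, ∃ C > 0, ∃ β > 0,
      ∀ (t₀ T : ℝ) (s : Quadrotor.Motion), 0 ≤ t₀ →
        s.IsClosedLoop p xd (Set.Ico t₀ T) Δx ΔR →
        (∀ t ∈ Set.Ico t₀ T,
          Quadrotor.specNorm ((2 : ℝ) • p.J - p.J.trace • (1 : Quadrotor.M3))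
            * ‖s.Ωc p xd (Set.Ico t₀ T) t‖ ≤ B2) →
        s.Ψ p xd t₀ < ψ1 → ‖s.ex xd t₀‖ < exmax →
        s.fullErr p xd (Set.Ico t₀ T) t₀ Δx ΔR < δ →
        ∀ t ∈ Set.Ico t₀ T,
          s.Ψ p xd t < ψ1 ∧ ‖s.ex xd t‖ < exmax ∧
          s.trackErr p xd (Set.Ico t₀ T) t
            ≤ C * s.fullErr p xd (Set.Ico t₀ T) t₀ Δx ΔR * Real.exp (-β * (t - t₀)) ∧
          ‖s.ei t‖ ≤ C ∧ ‖s.eI t‖ ≤ C) ∧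
    -- the same estimates from arbitrary initial errors, as long as the motion stays in the domain
    (∀ r > 0, ∃ C > 0, ∃ β > 0,
      ∀ (t₀ T : ℝ) (s : Quadrotor.Motion), 0 ≤ t₀ →
        s.IsClosedLoop p xd (Set.Ico t₀ T) Δx ΔR →
        (∀ t ∈ Set.Ico t₀ T,
          Quadrotor.specNorm ((2 : ℝ) • p.J - p.J.trace • (1 : Quadrotor.M3))
            * ‖s.Ωc p xd (Set.Ico t₀ T) t‖ ≤ B2) →
        (∀ t ∈ Set.Ico t₀ T, s.Ψ p xd t < ψ1 ∧ ‖s.ex xd t‖ < exmax) →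
        s.fullErr p xd (Set.Ico t₀ T) t₀ Δx ΔR ≤ r →
        ∀ t ∈ Set.Ico t₀ T,
          s.trackErr p xd (Set.Ico t₀ T) t
            ≤ C * s.fullErr p xd (Set.Ico t₀ T) t₀ Δx ΔR * Real.exp (-β * (t - t₀)) ∧
          ‖s.ei t‖ ≤ C ∧ ‖s.eI t‖ ≤ C) := by

  have hmain := fun {r : ℝ} (hr : 0 < r) => Quadrotor.Motion.exists_trackErr_le p xd Δx ΔR δx B1 B2
    ψ1 exmax α hm hJ hxd hB1 hΔx hkx hkv hki hkR hkΩ hkI hc1 hc2 hσ hψ1 hψ1' hα hkiσ hc1b hc2b hr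
  refine ⟨?_, fun r hr => ?_⟩
  · obtain ⟨C, hC, β, hβ, h⟩ := hmain one_pos
    have hψ2 : 0 < √(ψ1 / 2) := Real.sqrt_pos.2 (by positivity)
    -- The entry 1 is the radius for which `C` was obtained. The others force ‖e_x‖ ≤ exmax/2 and
    -- ‖e_R‖² ≤ ψ1/2 along the motion.
    refine ⟨min 1 (min (exmax / 2 / C) (√(ψ1 / 2) / C)), by positivity, C, hC, β, hβ, ?_⟩
    intro t₀ T s ht₀ hcl hB2 hΨ0 hex0 hfull t ht
    obtain ⟨hf1, hf2⟩ := lt_min_iff.1 hfull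
    obtain ⟨hf2, hf3⟩ := lt_min_iff.1 hf2
    rw [lt_div_iff₀ hC] at hf2 hf3
    have hJt : p.Jᵀ = p.J := by simpa [Matrix.IsHermitian] using hJ.isHermitian
    have hdyn := hcl.errorDynamics ht₀ hxd hJt hB1 hB2 hkx.le hkv.le hki.le hσ
    have h := h t₀ T s ht₀ hcl hB2 hf1.le
    have hsub : Set.Icc t₀ t ⊆ Set.Ico t₀ T := fun u hu => ⟨hu.1, hu.2.trans_lt ht.2⟩
    have hdom : ∀ u ∈ Set.Icc t₀ t, s.Ψ p xd u < ψ1 ∧ ‖s.ex xd u‖ < exmax := by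
      refine Quadrotor.lt_of_bootstrap
        (fun u hu => (hdyn.Ψ_deriv u (hsub hu)).continuousWithinAt.mono hsub)
        (fun u hu => (hdyn.ex_deriv u (hsub hu)).continuousWithinAt.norm.mono hsub)
        (half_lt_self hψ1) (half_lt_self hexmax) ⟨hΨ0, hex0⟩ fun u hu hdu => ?_
      have h1 := (h u (hsub hu) hdu).1
      have hf0 : 0 ≤ s.fullErr p xd (Set.Ico t₀ T) t₀ Δx ΔR := Real.sqrt_nonneg _
      have h2 : s.trackErr p xd (Set.Ico t₀ T) u
          ≤ s.fullErr p xd (Set.Ico t₀ T) t₀ Δx ΔR * C := by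
        refine h1.trans ?_
        rw [mul_comm C]
        refine mul_le_of_le_one_right (by positivity) (Real.exp_le_one_iff.2 ?_)
        nlinarith [hu.1]
      have hex : ‖s.ex xd u‖ ≤ s.trackErr p xd (Set.Ico t₀ T) u := by
        refine Real.le_sqrt_of_sq_le ?_
        linarith [sq_nonneg ‖s.ev xd u‖, sq_nonneg ‖s.eR p xd u‖,
          sq_nonneg ‖s.eΩ p xd (Set.Ico t₀ T) u‖]
      have heR : ‖s.eR p xd u‖ ≤ s.trackErr p xd (Set.Ico t₀ T) u := by
        refine Real.le_sqrt_of_sq_le ?_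
        linarith [sq_nonneg ‖s.ev xd u‖, sq_nonneg ‖s.ex xd u‖,
          sq_nonneg ‖s.eΩ p xd (Set.Ico t₀ T) u‖]
      have heR2 := (Real.le_sqrt (norm_nonneg _) (by positivity)).1 ((heR.trans h2).trans hf3.le)
      rw [hdyn.eR_sq u (hsub hu)] at heR2
      have hΨu := (hdu u (Set.right_mem_Icc.2 hu.1)).1
      have hΨn : 0 ≤ s.Ψ p xd u * (2 - s.Ψ p xd u) := hdyn.eR_sq u (hsub hu) ▸ sq_nonneg _
      have hΨ0' := nonneg_of_mul_nonneg_left hΨn (by linarith)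
      -- As 0 ≤ Ψ < 1, Ψ ≤ Ψ(2 - Ψ) = ‖e_R‖² ≤ ψ1/2, which is the strict improvement required by the
      -- bootstrap.
      exact ⟨by nlinarith, (hex.trans h2).trans hf2.le⟩
    obtain ⟨h1, h2, h3⟩ := h t ht hdom
    exact ⟨(hdom t (Set.right_mem_Icc.2 ht.1)).1, (hdom t (Set.right_mem_Icc.2 ht.1)).2, h1, h2, h3⟩
  · obtain ⟨C, hC, β, hβ, h⟩ := hmain hr
    refine ⟨C, hC, β, hβ, fun t₀ T s ht₀ hcl hB2 hdom hfull t ht => ?_⟩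
    exact h t₀ T s ht₀ hcl hB2 hfull t ht fun u hu => hdom u ⟨hu.1, hu.2.trans_lt ht.2⟩
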